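/- Let $N\ge 1$ and $p\in[1,\infty]$. There is a constant $C=C(p,N)>0$, depending only on $p$ and $N$, such that the following holds for every constant vector $a\in\mathbb{R}^N$, every $F\in C^1(\mathbb{R})$ with $F(0)=0$, and every real-valued $u_0\in L^1(\mathbb{R}^N)\cap L^\infty(\mathbb{R}^N)$. If $u\in C([0,\infty);L^1(\mathbb{R}^N))\cap L^\infty(\mathbb{R}^N\times(0,\infty))$ is a solution of $$u_t-\Delta u=a\cdot\nabla\bigl(F(u)\bigr)\ \text{ in }\mathbb{R}^N\times(0,\infty),\qquad u(0)=u_0,$$ that is, $u(0)=u_0$ in $L^1(\mathbb{R}^N)$ and $$\int_0^\infty\!\!\int_{\mathbb{R}^N}u\,(\varphi_t+\Delta\varphi)\,dx\,dt=\int_0^\infty\!\!\int_{\mathbb{R}^N}F(u)\,a\cdot\nabla\varphi\,dx\,dt\qquad\text{for all }\varphi\in C_c^\infty(\mathbb{R}^N\times(0,\infty)),$$ then $$\|u(t)\|_p\le C\,\|u_0\|_1\,t^{-\frac N2\left(1-\frac1p\right)}\qquad\text{for all }t>0.$$ -/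

import Mathlib

open MeasureTheory Filter Set
open scoped Topology ENNReal ContDiff

/-- The test functions `φ ∈ C_c^∞((0, ∞) × ℝᴺ)`: smooth real functions of time and space with compact
support contained in the open half space `t > 0`. -/
structure IsParabolicTest {N : ℕ} (φ : ℝ → EuclideanSpace ℝ (Fin N) → ℝ) : Prop where
  smooth : ContDiff ℝ ∞ (Function.uncurry φ)
  compact_support : HasCompactSupport (Function.uncurry φ)
  support_pos : tsupport (Function.uncurry φ) ⊆ Ioi 0 ×ˢ univ

/-- `u` is a solution of the Cauchy problem
`u_t - Δu = a · ∇(F(u))` in `ℝᴺ × (0, ∞)`, `u(0) = u₀`,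
in the class `C([0, ∞); L¹(ℝᴺ)) ∩ L^∞(ℝᴺ × (0, ∞))`. Here `u t x` is the value at time `t` and
position `x`; only times `t ≥ 0` matter. The equation holds in the sense of distributions on
`(0, ∞) × ℝᴺ`, and the initial datum is attained through the continuity in `L¹` at `t = 0`. -/
structure IsConvectionDiffusionSolution {N : ℕ} (a : EuclideanSpace ℝ (Fin N)) (F : ℝ → ℝ)
    (u₀ : EuclideanSpace ℝ (Fin N) → ℝ) (u : ℝ → EuclideanSpace ℝ (Fin N) → ℝ) : Prop where
  /-- `u(t) ∈ L¹(ℝᴺ)` for all `t ≥ 0`. -/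
  memLp_one : ∀ t : ℝ, 0 ≤ t → MemLp (u t) 1 volume
  /-- `t ↦ u(t)` is continuous from `[0, ∞)` to `L¹(ℝᴺ)`. -/
  continuous_L1 : ∀ t : ℝ, 0 ≤ t →
    Tendsto (fun s : ℝ => eLpNorm (u s - u t) 1 volume) (𝓝[Ici 0] t) (𝓝 0)
  /-- `u ∈ L^∞(ℝᴺ × (0, ∞))`. -/
  memLp_top : MemLp (Function.uncurry u) ⊤ (volume.restrict (Ioi (0 : ℝ) ×ˢ univ))
  /-- `u(0) = u₀`. -/
  initial : u 0 =ᵐ[volume] u₀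
  /-- The equation, tested against `φ` (all derivatives are moved to `φ`; `fderiv ℝ (φ t) x a` is
  `a · ∇φ(t, x)`). -/
  equation : ∀ φ : ℝ → EuclideanSpace ℝ (Fin N) → ℝ, IsParabolicTest φ →
    ∫ t in Ioi (0 : ℝ), ∫ x, u t x *
        (deriv (fun s => φ s x) t + Laplacian.laplacian (φ t) x) =
      ∫ t in Ioi (0 : ℝ), ∫ x, F (u t x) * fderiv ℝ (φ t) x a

/-! The decay comes from diffusion alone. For convex `J` with `J' = p` and `J'' = q ≥ 0`, multiply
the equation by `p(u)` and integrate. The convection term becomes, up to sign, the integral of `q(u)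
F(u) a·∇u`, which is the directional derivative of a function of `u` and integrates to zero.
Formally, then, `d/dt ∫ J(u) = -∫ q(u) |∇u|²`, with no trace of `a` or `F`.

A weak solution is too rough for this computation, so it is carried out for `U = k ∗ u`, with `k` a
smooth kernel in space. This `U` solves `∂ₜU = ΔU + a·∇(k ∗ F(u))` pointwise
(`hasDerivAt_mollify_of_weak`). Convection now survives only through the commutator `k ∗ F(u) - F(k
∗ u)`. Young's inequality bounds it by half of the dissipation plus a multiple of its squared `L²`
norm (`integral_comp_mollify_mul_rhs_le`). That norm tends to zero as the kernel concentrates, which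
leaves a time-weighted energy inequality with half of the dissipation
(`IsMollifiedSolution.energy_le`).

The rest is a Nash–Moser iteration in dimension `d`. Regularisations of `J(s) = |s|` show that the
`L¹` norm does not increase. For `J(s) = s^(2n+2)` and the weight `t^(d(n+1))`, Nash's inequality
for `U^(n+1)` turns decay of the moment of order `n + 1` into decay of the moment of order `2n + 2`
(`integral_pow_step`). The constants grow only geometrically in the order, so Chebyshev's inequality
along the iteration gives the `L^∞` bound (`ae_abs_le`). Interpolation with `L¹` covers all `p`. -/

/-- Smooth, compactly supported real functions. -/
structure IsBump {E : Type*} [NormedAddCommGroup E] [NormedSpace ℝ E] (k : E → ℝ) : Prop where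
  smooth : ContDiff ℝ ∞ k
  compact : HasCompactSupport k

/-- The convolution of `f` with the kernel `k`. -/
noncomputable def mollify {E : Type*} [NormedAddCommGroup E] [MeasureSpace E]
    (k f : E → ℝ) (x : E) : ℝ := ∫ y, f y * k (x - y)

/-! ### Smooth kernels and mollification in space. -/

section Bump

variable {E : Type*} [NormedAddCommGroup E] [InnerProductSpace ℝ E]

theorem IsBump.continuous {k : E → ℝ} (hk : IsBump k) : Continuous k := hk.smooth.continuous

theorem IsBump.fderiv_apply {k : E → ℝ} (hk : IsBump k) (e : E) :
    IsBump (fun x => fderiv ℝ k x e) :=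
  ⟨(hk.smooth.fderiv_right (m := ∞) (by simp)).clm_apply contDiff_const,
    (hk.compact.fderiv ℝ).comp_left (g := fun l : E →L[ℝ] ℝ => l e) (by simp)⟩

theorem IsBump.exists_bound {k : E → ℝ} (hk : IsBump k) : ∃ B, 0 ≤ B ∧ ∀ x, |k x| ≤ B := by
  obtain ⟨B, hB⟩ := hk.compact.exists_bound_of_continuous hk.continuous
  exact ⟨B, (norm_nonneg _).trans (hB 0), hB⟩

end Bump

section Mollify

variable {E : Type*} [NormedAddCommGroup E] [InnerProductSpace ℝ E] [FiniteDimensional ℝ E]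
  [MeasurableSpace E] [BorelSpace E]

theorem mollify_eq_convolution (k f : E → ℝ) :
    mollify k f = convolution f k (ContinuousLinearMap.mul ℝ ℝ) volume := rfl

theorem IsBump.integrable {k : E → ℝ} (hk : IsBump k) : Integrable k :=
  hk.continuous.integrable_of_hasCompactSupport hk.compact

theorem integrable_mul_bump {k f : E → ℝ} (hk : IsBump k) (hf : Integrable f) (x : E) :
    Integrable (fun y => f y * k (x - y)) := by
  obtain ⟨B, hB0, hB⟩ := hk.exists_bound
  have hc : Continuous fun y => k (x - y) := hk.continuous.comp (continuous_sub_left x)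
  exact hf.mul_bdd hc.aestronglyMeasurable (Eventually.of_forall fun y => hB _)

theorem abs_mollify_le {k f : E → ℝ} {B : ℝ} (hB : ∀ x, |k x| ≤ B) (hf : Integrable f)
    (x : E) : |mollify k f x| ≤ B * ∫ y, |f y| := by
  rw [← integral_const_mul, mollify, ← Real.norm_eq_abs]
  refine norm_integral_le_of_norm_le (hf.abs.const_mul B) (Eventually.of_forall fun y => ?_)
  rw [Real.norm_eq_abs, abs_mul, mul_comm]
  exact mul_le_mul_of_nonneg_right (hB _) (abs_nonneg _)

theorem mollify_sub {k f g : E → ℝ} (hk : IsBump k) (hf : Integrable f) (hg : Integrable g)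
    (x : E) : mollify k (fun y => f y - g y) x = mollify k f x - mollify k g x := by
  simp only [mollify, sub_mul]
  exact integral_sub (integrable_mul_bump hk hf x) (integrable_mul_bump hk hg x)

theorem contDiff_mollify {k f : E → ℝ} (hk : IsBump k) (hf : Integrable f) :
    ContDiff ℝ ∞ (mollify k f) :=
  hk.compact.contDiff_convolution_right (ContinuousLinearMap.mul ℝ ℝ) hf.locallyIntegrable hk.smooth

theorem differentiable_mollify {k f : E → ℝ} (hk : IsBump k) (hf : Integrable f) :
    Differentiable ℝ (mollify k f) :=
  (contDiff_mollify hk hf).differentiable (by simp)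

theorem continuous_mollify {k f : E → ℝ} (hk : IsBump k) (hf : Integrable f) :
    Continuous (mollify k f) :=
  (contDiff_mollify hk hf).continuous

theorem fderiv_mollify_apply {k f : E → ℝ} (hk : IsBump k) (hf : Integrable f) (x e : E) :
    fderiv ℝ (mollify k f) x e = mollify (fun z => fderiv ℝ k z e) f x := by
  have h := hk.compact.hasFDerivAt_convolution_right (ContinuousLinearMap.mul ℝ ℝ)
    hf.locallyIntegrable (hk.smooth.of_le (by simp)) x (μ := volume)
  rw [mollify_eq_convolution, h.fderiv, convolution_precompR_apply _ hf.locallyIntegrable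
    (hk.compact.fderiv ℝ) (hk.smooth.continuous_fderiv (by simp))]
  rfl

theorem integrable_mollify {k f : E → ℝ} (hk : IsBump k) (hf : Integrable f) :
    Integrable (mollify k f) :=
  hf.integrable_convolution (ContinuousLinearMap.mul ℝ ℝ) hk.integrable

theorem integral_mollify {k f : E → ℝ} (hk : IsBump k) (hf : Integrable f) :
    ∫ x, mollify k f x = (∫ x, f x) * ∫ x, k x :=
  integral_convolution (ContinuousLinearMap.mul ℝ ℝ) hf hk.integrable

theorem integral_abs_mollify_le {k f : E → ℝ} (hk : IsBump k) (hf : Integrable f) :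
    ∫ x, |mollify k f x| ≤ (∫ x, |f x|) * ∫ x, |k x| := by
  have h : ∫ x, convolution (fun y => |f y|) (fun y => |k y|)
      (ContinuousLinearMap.mul ℝ ℝ) volume x = (∫ x, |f x|) * ∫ x, |k x| :=
    integral_convolution (ContinuousLinearMap.mul ℝ ℝ) hf.abs hk.integrable.abs
  rw [← h]
  refine integral_mono (integrable_mollify hk hf).abs
    (hf.abs.integrable_convolution (ContinuousLinearMap.mul ℝ ℝ) hk.integrable.abs) fun x => ?_
  refine (abs_integral_le_integral_abs).trans_eq ?_
  simp [convolution, abs_mul]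

/-- Nonnegative smooth kernels of unit mass. -/
structure IsMollifier (k : E → ℝ) : Prop extends IsBump k where
  nonneg : ∀ x, 0 ≤ k x
  integral_eq_one : ∫ x, k x = 1

theorem IsMollifier.integral_sub_left {k : E → ℝ} (hk : IsMollifier k) (x : E) :
    ∫ y, k (x - y) = 1 := by
  rw [integral_sub_left_eq_self k volume x, hk.integral_eq_one]

theorem IsMollifier.integral_abs {k : E → ℝ} (hk : IsMollifier k) : ∫ x, |k x| = 1 := by
  simp_rw [abs_of_nonneg (hk.nonneg _)]
  exact hk.integral_eq_one

theorem IsMollifier.integrable_sub_left {k : E → ℝ} (hk : IsMollifier k) (x : E) :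
    Integrable (fun y => k (x - y)) :=
  hk.toIsBump.integrable.comp_sub_left x

theorem IsMollifier.abs_mollify_le {k f : E → ℝ} (hk : IsMollifier k) {M : ℝ}
    (hM : ∀ x, |f x| ≤ M) (x : E) : |mollify k f x| ≤ M := by
  have h : ∫ y, M * k (x - y) = M := by
    rw [integral_const_mul, hk.integral_sub_left, mul_one]
  rw [← h]
  rw [mollify, ← Real.norm_eq_abs]
  refine norm_integral_le_of_norm_le ((hk.integrable_sub_left x).const_mul M)
    (Eventually.of_forall fun y => ?_)
  rw [Real.norm_eq_abs, abs_mul, abs_of_nonneg (hk.nonneg _)]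
  exact mul_le_mul_of_nonneg_right (hM y) (hk.nonneg _)

theorem integrable_abs_pow {f : E → ℝ} (hf : Integrable f) {M : ℝ}
    (hM : ∀ x, |f x| ≤ M) {m : ℕ} (hm : 1 ≤ m) : Integrable (fun x => |f x| ^ m) := by
  obtain ⟨n, rfl⟩ := Nat.exists_eq_add_of_le' hm
  have hm := hf.abs.aestronglyMeasurable.pow n
  refine (hf.abs.mul_bdd (c := M ^ n) hm (Eventually.of_forall fun x => ?_)).congr
    (Eventually.of_forall fun x => ?_)
  · simp only [Pi.pow_apply, norm_pow, Real.norm_eq_abs, abs_abs]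
    exact pow_le_pow_left₀ (abs_nonneg _) (hM x) n
  · simp [pow_succ, mul_comm]

/-- The graph of `s ^ m` lies above its tangent at `c`. For `c > 0` this is Bernoulli's inequality
for `a / c - 1`, scaled by `c ^ m`. -/
theorem pow_add_mul_sub_le {a c : ℝ} (ha : 0 ≤ a) (hc : 0 ≤ c) {m : ℕ} (hm : 1 ≤ m) :
    c ^ m + m * c ^ (m - 1) * (a - c) ≤ a ^ m := by
  rcases hc.eq_or_lt with rfl | hc
  · rcases Nat.lt_or_ge 1 m with h | h
    · have h1 : m - 1 ≠ 0 := by omega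
      have h2 : m ≠ 0 := by omega
      simp [h1, h2, ha]
    · obtain rfl : m = 1 := by omega
      simp
  · have h := one_add_mul_le_pow (a := a / c - 1) (by
      have : 0 ≤ a / c := by positivity
      linarith) m
    have h3 := mul_le_mul_of_nonneg_left h (pow_nonneg hc.le m)
    rw [← mul_pow] at h3
    obtain ⟨n, rfl⟩ := Nat.exists_eq_add_of_le' hm
    have e1 : c * (1 + (a / c - 1)) = a := by field_simp; ring
    rw [e1] at h3
    refine le_trans (le_of_eq ?_) h3
    simp only [Nat.add_sub_cancel, pow_succ]
    field_simp

/-- Jensen's inequality for mollifications. -/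
theorem IsMollifier.integral_abs_mollify_pow_le {k f : E → ℝ} (hk : IsMollifier k)
    (hf : Integrable f) {M : ℝ} (hM : ∀ x, |f x| ≤ M) {m : ℕ} (hm : 1 ≤ m) :
    ∫ x, |mollify k f x| ^ m ≤ ∫ x, |f x| ^ m := by
  have hfm := integrable_abs_pow hf hM hm
  have h : ∫ x, mollify k (fun y => |f y| ^ m) x = ∫ x, |f x| ^ m := by
    rw [integral_mollify hk.toIsBump hfm, hk.integral_eq_one, mul_one]
  rw [← h]
  refine integral_mono (integrable_abs_pow (integrable_mollify hk.toIsBump hf)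
    (hk.abs_mollify_le hM) hm) (integrable_mollify hk.toIsBump hfm) fun x => ?_
  set c := mollify k (fun y => |f y|) x with hc
  have hc0 : 0 ≤ c := integral_nonneg fun y => mul_nonneg (abs_nonneg _) (hk.nonneg _)
  have hle : |mollify k f x| ≤ c := by
    refine (abs_integral_le_integral_abs).trans_eq ?_
    simp [hc, mollify, abs_mul, abs_of_nonneg (hk.nonneg _)]
  refine (pow_le_pow_left₀ (abs_nonneg _) hle m).trans ?_
  have i1 := hk.integrable_sub_left x
  have i2 := integrable_mul_bump hk.toIsBump hf.abs x
  -- Integrate the tangent at `c` against the probability density `k (x - ·)`: the linear term drops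
  -- out because `c` is the mean of `|f|`.
  have e : ∫ y, (c ^ m * k (x - y) + m * c ^ (m - 1) * (|f y| * k (x - y) - c * k (x - y)))
      = c ^ m := by
    have i3 : Integrable (fun y => |f y| * k (x - y) - c * k (x - y)) :=
      i2.sub (i1.const_mul _)
    rw [integral_add (i1.const_mul _) (i3.const_mul _),
      integral_const_mul, integral_const_mul, integral_sub i2 (i1.const_mul _),
      integral_const_mul, hk.integral_sub_left]
    simp [hc, mollify]
  rw [← e]
  refine integral_mono ((i1.const_mul _).add ((i2.sub (i1.const_mul _)).const_mul _))
    (integrable_mul_bump hk.toIsBump hfm x) fun y => ?_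
  have := mul_le_mul_of_nonneg_right
    (pow_add_mul_sub_le (abs_nonneg (f y)) hc0 hm) (hk.nonneg (x - y))
  simp only
  linarith

/-- Translations are continuous in `L¹`. -/
theorem tendsto_integral_abs_translate_sub {f : E → ℝ} (hf : Integrable f) :
    Tendsto (fun y => ∫ x, |f (x - y) - f x|) (𝓝 0) (𝓝 0) := by
  have hf1 : MemLp f 1 volume := memLp_one_iff_integrable.2 hf
  have : Fact ((1 : ℝ≥0∞) ≠ ⊤) := ⟨by simp⟩
  have hc : Tendsto (fun y : E => DomAddAct.mk (-y) +ᵥ hf1.toLp f) (𝓝 0)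
      (𝓝 (DomAddAct.mk (-(0 : E)) +ᵥ hf1.toLp f)) := by
    have h1 : Continuous fun y : E => DomAddAct.mk (-y) := by
      exact DomAddAct.continuous_mk.comp continuous_neg
    have : Continuous fun y : E => DomAddAct.mk (-y) +ᵥ hf1.toLp f :=
      h1.vadd continuous_const
    exact this.tendsto 0
  rw [tendsto_iff_dist_tendsto_zero] at hc
  refine hc.congr fun y => ?_
  simp only [DomAddAct.mk_vadd_toLp]
  rw [dist_eq_norm, ← MemLp.toLp_sub, L1.norm_eq_integral_norm]
  refine integral_congr_ae ?_
  filter_upwards [MemLp.coeFn_toLp (MemLp.sub (hf1.comp_measurePreserving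
    (measurePreserving_vadd (-y) volume)) (hf1.comp_measurePreserving
    (measurePreserving_vadd (-(0:E)) volume)))] with x hx
  refine (congrArg norm hx).trans ?_
  simp [Real.norm_eq_abs, neg_add_eq_sub]

/-- Since `k` has mass one, `k ∗ f - f` is the average of `f(· - y) - f` with weight `k(y)`. By
Fubini its `L¹` norm is at most the average of the translation errors, and only `‖y‖ < r`
contributes. -/
theorem IsMollifier.integral_abs_mollify_sub_le {k f : E → ℝ} (hk : IsMollifier k)
    (hf : Integrable f) {r δ : ℝ} (hr : ∀ x, k x ≠ 0 → ‖x‖ < r)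
    (hδ : ∀ y, ‖y‖ < r → ∫ x, |f (x - y) - f x| ≤ δ) :
    ∫ x, |mollify k f x - f x| ≤ δ := by
  have hI : Integrable (fun p : E × E => (f (p.1 - p.2) - f p.1) * k p.2)
      (volume.prod volume) := by
    have a1 : Integrable (fun p : E × E => f (p.1 - p.2) * k p.2) (volume.prod volume) := by
      have := hk.toIsBump.integrable.convolution_integrand
        (ContinuousLinearMap.mul ℝ ℝ) hf (μ := volume) (ν := volume)
      refine this.congr (Eventually.of_forall fun p => ?_)
      simp [mul_comm]
    have a2 : Integrable (fun p : E × E => f p.1 * k p.2) (volume.prod volume) :=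
      hf.mul_prod hk.toIsBump.integrable
    simpa only [sub_mul] using! a1.sub a2
  have hpt : ∀ x, |mollify k f x - f x| ≤ ∫ y, |f (x - y) - f x| * k y := by
    intro x
    have e : mollify k f x - f x = ∫ y, (f (x - y) - f x) * k y := by
      have e1 : mollify k f x = ∫ y, f (x - y) * k y := by
        rw [mollify, ← integral_sub_left_eq_self (fun y => f y * k (x - y)) volume x]
        simp
      have i1 : Integrable (fun y => f (x - y) * k y) := by
        have := (integrable_mul_bump hk.toIsBump hf x).comp_sub_left x
        simpa using this
      simp only [sub_mul]
      rw [integral_sub i1 (hk.toIsBump.integrable.const_mul _), integral_const_mul,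
        hk.integral_eq_one, e1, mul_one]
    rw [e]
    refine (abs_integral_le_integral_abs).trans_eq ?_
    simp [abs_mul, abs_of_nonneg (hk.nonneg _)]
  have hI' : Integrable (fun p : E × E => |f (p.1 - p.2) - f p.1| * k p.2)
      (volume.prod volume) := by
    refine hI.norm.congr (Eventually.of_forall fun p => ?_)
    simp [abs_of_nonneg (hk.nonneg _)]
  calc ∫ x, |mollify k f x - f x| ≤ ∫ x, ∫ y, |f (x - y) - f x| * k y :=
        integral_mono ((integrable_mollify hk.toIsBump hf).sub hf).abs hI'.integral_prod_left hpt
    _ = ∫ y, ∫ x, |f (x - y) - f x| * k y := integral_integral_swap hI'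
    _ ≤ ∫ y, δ * k y := by
        refine integral_mono hI'.integral_prod_right (hk.toIsBump.integrable.const_mul _)
          fun y => ?_
        simp only
        rw [integral_mul_const]
        by_cases hy : k y = 0
        · simp [hy]
        · exact mul_le_mul_of_nonneg_right (hδ y (hr y hy)) (hk.nonneg y)
    _ = δ := by rw [integral_const_mul, hk.integral_eq_one, mul_one]

/-- A sequence of mollifiers concentrating at the origin. -/
theorem exists_mollifier_seq (E : Type*) [NormedAddCommGroup E] [InnerProductSpace ℝ E]
    [FiniteDimensional ℝ E] [MeasurableSpace E] [BorelSpace E] :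
    ∃ k : ℕ → E → ℝ, (∀ n, IsMollifier (k n)) ∧
      ∀ f : E → ℝ, Integrable f →
        Tendsto (fun n => ∫ x, |mollify (k n) f x - f x|) atTop (𝓝 0) := by
  let φ : ℕ → ContDiffBump (0 : E) := fun n =>
    ⟨1 / (2 * (n + 1 : ℝ)), 1 / (n + 1 : ℝ), by positivity, by
      apply one_div_lt_one_div_of_lt <;> [positivity; linarith [n.cast_nonneg (α := ℝ)]]⟩
  have hφ : ∀ n, IsMollifier ((φ n).normed volume) := fun n =>
    ⟨⟨(φ n).contDiff_normed, (φ n).hasCompactSupport_normed⟩, (φ n).nonneg_normed,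
      (φ n).integral_normed⟩
  refine ⟨fun n => (φ n).normed volume, hφ, fun f hf => ?_⟩
  rw [Metric.tendsto_atTop]
  intro ε hε
  have h := tendsto_integral_abs_translate_sub hf
  rw [Metric.tendsto_nhds_nhds] at h
  obtain ⟨r, hr, h⟩ := h (ε / 2) (by positivity)
  obtain ⟨n₀, hn₀⟩ := exists_nat_one_div_lt hr
  refine ⟨n₀, fun n hn => ?_⟩
  rw [Real.dist_eq, sub_zero, abs_of_nonneg (integral_nonneg fun _ => abs_nonneg _)]
  refine lt_of_le_of_lt ((hφ n).integral_abs_mollify_sub_le hf (r := r) (δ := ε / 2) ?_ ?_)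
    (by linarith)
  · intro x hx
    have : x ∈ Function.support ((φ n).normed volume) := hx
    rw [(φ n).support_normed_eq] at this
    have h1 : ‖x‖ < 1 / (n + 1 : ℝ) := by simpa [φ] using this
    refine h1.trans (lt_of_le_of_lt ?_ hn₀)
    exact one_div_le_one_div_of_le (by positivity) (by exact_mod_cast Nat.succ_le_succ hn)
  · intro y hy
    have := h (x := y) (by simpa using hy)
    rw [Real.dist_eq, sub_zero, abs_of_nonneg (integral_nonneg fun _ => abs_nonneg _)] at this
    exact this.le

end Mollify

/-! ### Nash's inequality by averaging over translations. -/

theorem sq_integral_le_integral_sq {g : ℝ → ℝ} (hg : Continuous g) :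
    (∫ s in (0 : ℝ)..1, g s) ^ 2 ≤ ∫ s in (0 : ℝ)..1, g s ^ 2 := by
  set c := ∫ s in (0 : ℝ)..1, g s with hc
  -- The variance of `g` on the unit interval is nonnegative.
  have h : 0 ≤ ∫ s in (0 : ℝ)..1, (g s - c) ^ 2 :=
    intervalIntegral.integral_nonneg zero_le_one fun s _ => sq_nonneg _
  have e : ∀ s, (g s - c) ^ 2 = g s ^ 2 - (2 * c) * g s + c ^ 2 := fun s => by ring
  have i1 : IntervalIntegrable (fun s => g s ^ 2) volume 0 1 := (hg.pow 2).intervalIntegrable _ _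
  have i2 : IntervalIntegrable (fun s => (2 * c) * g s) volume 0 1 :=
    (hg.const_mul _).intervalIntegrable _ _
  simp_rw [e] at h
  rw [intervalIntegral.integral_add (i1.sub i2) intervalIntegrable_const,
    intervalIntegral.integral_sub i1 i2, intervalIntegral.integral_const_mul, ← hc] at h
  simp only [intervalIntegral.integral_const, sub_zero, one_smul] at h
  linarith

section Nash

variable {E : Type*} [NormedAddCommGroup E] [InnerProductSpace ℝ E] [FiniteDimensional ℝ E]
  [MeasurableSpace E] [BorelSpace E]

theorem integrable_sq {V : E → ℝ} (hi : Integrable V) {B : ℝ} (hB : ∀ x, |V x| ≤ B) :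
    Integrable (fun x => V x ^ 2) := by
  simpa [sq_abs] using integrable_abs_pow hi hB (m := 2) (by norm_num)

/-- Write the increment as an integral of the gradient along the segment from `x` to `x + y`, apply
Cauchy–Schwarz on the segment, then Fubini and translation invariance. -/
theorem integral_sq_translate_sub_le {V : E → ℝ} (hV : ContDiff ℝ 1 V) (hi : Integrable V)
    {B : ℝ} (hB : ∀ x, |V x| ≤ B) (hg : Integrable (fun x => ‖fderiv ℝ V x‖ ^ 2)) (y : E) :
    ∫ x, (V (x + y) - V x) ^ 2 ≤ ‖y‖ ^ 2 * ∫ x, ‖fderiv ℝ V x‖ ^ 2 := by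
  set G : E → ℝ := fun x => ‖fderiv ℝ V x‖ ^ 2 with hG
  have hfc : Continuous (fderiv ℝ V) := hV.continuous_fderiv (by simp)
  have hGc : Continuous G := hfc.norm.pow 2
  have hpt : ∀ x, (V (x + y) - V x) ^ 2 ≤ ∫ s in (0 : ℝ)..1, ‖y‖ ^ 2 * G (x + s • y) := by
    intro x
    have hd : ∀ s ∈ uIcc (0 : ℝ) 1, HasDerivAt (fun s : ℝ => V (x + s • y))
        (fderiv ℝ V (x + s • y) y) s := by
      intro s _
      have h1 : HasDerivAt (fun s : ℝ => x + s • y) y s := by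
        simpa using ((hasDerivAt_id s).smul_const y).const_add x
      exact ((hV.differentiable (by simp)) (x + s • y)).hasFDerivAt.comp_hasDerivAt s h1
    have hcont : Continuous fun s : ℝ => fderiv ℝ V (x + s • y) y :=
      (hfc.comp (by fun_prop)).clm_apply continuous_const
    have h := intervalIntegral.integral_eq_sub_of_hasDerivAt hd (hcont.intervalIntegrable _ _)
    simp only [one_smul, zero_smul, add_zero] at h
    rw [← h]
    refine (sq_integral_le_integral_sq hcont).trans ?_
    refine intervalIntegral.integral_mono_on zero_le_one
      ((hcont.pow 2).intervalIntegrable _ _) (Continuous.intervalIntegrable (by fun_prop) _ _)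
      fun s _ => ?_
    rw [← sq_abs, hG]
    have := (fderiv ℝ V (x + s • y)).le_opNorm y
    rw [Real.norm_eq_abs] at this
    calc |fderiv ℝ V (x + s • y) y| ^ 2 ≤ (‖fderiv ℝ V (x + s • y)‖ * ‖y‖) ^ 2 :=
          pow_le_pow_left₀ (abs_nonneg _) this 2
      _ = _ := by ring
  have hint : Integrable (fun p : E × ℝ => ‖y‖ ^ 2 * G (p.1 + p.2 • y))
      (volume.prod (volume.restrict (Ioc (0 : ℝ) 1))) := by
    refine Integrable.const_mul ?_ _
    have hc : Continuous fun p : E × ℝ => G (p.1 + p.2 • y) := hGc.comp (by fun_prop)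
    refine (integrable_prod_iff' hc.aestronglyMeasurable).2 ⟨Eventually.of_forall fun s =>
      hg.comp_add_right (s • y), ?_⟩
    have : ∀ s : ℝ, ∫ x, ‖G (x + s • y)‖ = ∫ x, ‖G x‖ := fun s =>
      integral_add_right_eq_self (fun x => ‖G x‖) (s • y)
    simp_rw [this]
    exact integrable_const _
  have hL : Integrable (fun x => (V (x + y) - V x) ^ 2) := by
    refine integrable_sq ((hi.comp_add_right y).sub hi) (B := B + B) fun x => ?_
    exact (abs_sub _ _).trans (add_le_add (hB _) (hB _))
  calc ∫ x, (V (x + y) - V x) ^ 2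
      ≤ ∫ x, ∫ s in Ioc (0 : ℝ) 1, ‖y‖ ^ 2 * G (x + s • y) := by
        refine integral_mono hL hint.integral_prod_left fun x => ?_
        have := hpt x
        rwa [intervalIntegral.integral_of_le zero_le_one] at this
    _ = ∫ s in Ioc (0 : ℝ) 1, ∫ x, ‖y‖ ^ 2 * G (x + s • y) := integral_integral_swap hint
    _ = ∫ s in Ioc (0 : ℝ) 1, ‖y‖ ^ 2 * ∫ x, G x := by
        congr 1
        ext s
        rw [integral_const_mul, integral_add_right_eq_self G (s • y)]
    _ = ‖y‖ ^ 2 * ∫ x, G x := by simp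

/-- A linear form of Nash's inequality, with a free length scale `r`. -/
theorem integral_sq_le_of_scale {V : E → ℝ} (hV : ContDiff ℝ 1 V) (hi : Integrable V)
    {B : ℝ} (hB : ∀ x, |V x| ≤ B) (hg : Integrable (fun x => ‖fderiv ℝ V x‖ ^ 2))
    {r : ℝ} (hr : 0 < r) :
    ∫ x, V x ^ 2 ≤ r ^ 2 / 2 * (∫ x, ‖fderiv ℝ V x‖ ^ 2)
      + (∫ x, |V x|) ^ 2 / volume.real (Metric.ball (0 : E) r) := by
  set G := ∫ x, ‖fderiv ℝ V x‖ ^ 2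
  set vol := volume.real (Metric.ball (0 : E) r)
  have hvol : 0 < vol := ENNReal.toReal_pos (Metric.measure_ball_pos _ _ hr).ne'
    measure_ball_lt_top.ne
  have hG : 0 ≤ G := integral_nonneg fun x => sq_nonneg _
  have hprod : Integrable (fun p : E × E => |V p.1| * |V (p.1 + p.2)|)
      (volume.prod volume) := by
    have hc : Continuous fun p : E × E => |V p.1| * |V (p.1 + p.2)| := by
      have := hV.continuous
      fun_prop
    refine (integrable_prod_iff hc.aestronglyMeasurable).2 ⟨Eventually.of_forall fun x =>
      (hi.abs.comp_add_left x).const_mul |V x|, ?_⟩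
    have : ∀ x, ∫ y, ‖|V x| * |V (x + y)|‖ = |V x| * ∫ y, |V y| := fun x => by
      simp only [norm_mul, Real.norm_eq_abs, abs_abs]
      rw [integral_const_mul, integral_add_left_eq_self (fun y => |V y|) x]
    simp_rw [this]
    exact hi.abs.mul_const _
  have hswap : ∫ y, ∫ x, |V x| * |V (x + y)| = (∫ x, |V x|) ^ 2 := by
    rw [← integral_integral_swap hprod]
    have : ∀ x, ∫ y, |V x| * |V (x + y)| = |V x| * ∫ y, |V y| := fun x => by
      rw [integral_const_mul, integral_add_left_eq_self (fun y => |V y|) x]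
    simp_rw [this]
    rw [integral_mul_const, sq]
  -- Expanding the square of the increment gives `∫ V² = ∫ V V(· + y) + ½ ∫ (V(· + y) - V)²`, and
  -- the last term is controlled by the gradient.
  have hpt : ∀ y ∈ Metric.ball (0 : E) r,
      ∫ x, V x ^ 2 ≤ r ^ 2 / 2 * G + ∫ x, |V x| * |V (x + y)| := by
    intro y hy
    have i0 := integrable_sq hi hB
    have i1 : Integrable fun x => V (x + y) ^ 2 := i0.comp_add_right y
    have i2 : Integrable fun x => V x * V (x + y) :=
      (hi.comp_add_right y).bdd_mul hV.continuous.aestronglyMeasurable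
        (Eventually.of_forall hB)
    have e : ∀ x, (V (x + y) - V x) ^ 2 = V (x + y) ^ 2 + V x ^ 2 - 2 * (V x * V (x + y)) :=
      fun x => by ring
    have h := integral_sq_translate_sub_le hV hi hB hg y
    simp_rw [e] at h
    have i10 : Integrable fun x => V (x + y) ^ 2 + V x ^ 2 := i1.add i0
    rw [integral_sub i10 (i2.const_mul 2), integral_add i1 i0,
      integral_add_right_eq_self (fun x => V x ^ 2) y, integral_const_mul] at h
    have h2 : ∫ x, V x * V (x + y) ≤ ∫ x, |V x| * |V (x + y)| := by
      refine integral_mono i2 (i2.abs.congr (Eventually.of_forall fun x => abs_mul _ _))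
        fun x => ?_
      rw [← abs_mul]
      exact le_abs_self _
    have h3 : ‖y‖ ^ 2 * G ≤ r ^ 2 * G := by
      refine mul_le_mul_of_nonneg_right (pow_le_pow_left₀ (norm_nonneg _) ?_ 2) hG
      simpa using (mem_ball_zero_iff.1 hy).le
    linarith
  have hc1 : ∫ _ in Metric.ball (0 : E) r, (∫ x, V x ^ 2) = vol * ∫ x, V x ^ 2 := by
    rw [setIntegral_const, smul_eq_mul]
  have hfin : volume (Metric.ball (0 : E) r) ≠ ⊤ := measure_ball_lt_top.ne
  have i3 : Integrable (fun y => ∫ x, |V x| * |V (x + y)|) := hprod.integral_prod_right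
  -- Integrate over `y` in the ball. The correlation term, extended to all `y`, equals `‖V‖₁²`.
  have h1 : vol * ∫ x, V x ^ 2 ≤ vol * (r ^ 2 / 2 * G) + (∫ x, |V x|) ^ 2 := by
    rw [← hc1, ← hswap]
    have i4 : IntegrableOn (fun _ : E => r ^ 2 / 2 * G) (Metric.ball 0 r) :=
      integrableOn_const hfin
    refine (setIntegral_mono_on (integrableOn_const hfin)
      (i4.add i3.integrableOn) measurableSet_ball hpt).trans ?_
    rw [integral_add' i4 i3.integrableOn, setIntegral_const, smul_eq_mul]
    refine add_le_add le_rfl (setIntegral_le_integral i3 (Eventually.of_forall fun y => ?_))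
    exact integral_nonneg fun x => mul_nonneg (abs_nonneg _) (abs_nonneg _)
  have h2 : ∫ x, V x ^ 2 ≤ (vol * (r ^ 2 / 2 * G) + (∫ x, |V x|) ^ 2) / vol := by
    rw [le_div_iff₀ hvol, mul_comm]
    exact h1
  rwa [add_div, mul_div_cancel_left₀ _ hvol.ne'] at h2

end Nash

/-! ### Dissipation of convex energies along the mollified equation. -/

theorem sum_sq_apply_orthonormalBasis {E ι : Type*} [NormedAddCommGroup E] [InnerProductSpace ℝ E]
    [FiniteDimensional ℝ E] [Fintype ι] (b : OrthonormalBasis ι ℝ E)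
    (l : E →L[ℝ] ℝ) : ∑ i, l (b i) ^ 2 = ‖l‖ ^ 2 := by
  obtain ⟨v, rfl⟩ := (InnerProductSpace.toDual ℝ E).surjective l
  rw [LinearIsometryEquiv.norm_map, ← b.sum_sq_norm_inner_left v]
  simp

section Dissipation

variable {E : Type*} [NormedAddCommGroup E] [InnerProductSpace ℝ E] [FiniteDimensional ℝ E]
  [MeasurableSpace E] [BorelSpace E]

/-- The right-hand side `ΔU + a·∇H` for `U = k ∗ f` and `H = k ∗ g`. -/
noncomputable def mollifiedRHS (a : E) (k f g : E → ℝ) (x : E) : ℝ :=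
  ∑ i, mollify (fun z => fderiv ℝ (fun w => fderiv ℝ k w (stdOrthonormalBasis ℝ E i)) z
    (stdOrthonormalBasis ℝ E i)) f x + mollify (fun z => fderiv ℝ k z a) g x

theorem integrable_mollifiedRHS (a : E) {k f g : E → ℝ} (hk : IsBump k) (hf : Integrable f)
    (hg : Integrable g) : Integrable (mollifiedRHS a k f g) :=
  (integrable_finsetSum _ fun _ _ =>
    integrable_mollify ((hk.fderiv_apply _).fderiv_apply _) hf).add
    (integrable_mollify (hk.fderiv_apply a) hg)

theorem fderiv_comp_mollify_apply {p q : ℝ → ℝ} (hp : ∀ s, HasDerivAt p (q s) s)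
    {k f : E → ℝ} (hk : IsBump k) (hf : Integrable f) (x e : E) :
    fderiv ℝ (fun x => p (mollify k f x)) x e
      = q (mollify k f x) * mollify (fun z => fderiv ℝ k z e) f x := by
  have h := (hp (mollify k f x)).comp_hasFDerivAt x (differentiable_mollify hk hf x).hasFDerivAt
  have h' : fderiv ℝ (fun x => p (mollify k f x)) x = q (mollify k f x) •
    fderiv ℝ (mollify k f) x := h.fderiv
  rw [h']
  simp [fderiv_mollify_apply hk hf]

theorem integrable_comp_mollify_mul {p : ℝ → ℝ} (hp : Continuous p) {k f g : E → ℝ}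
    (hk : IsBump k) (hf : Integrable f) (hg : Integrable g) :
    Integrable (fun x => p (mollify k f x) * g x) := by
  obtain ⟨B, -, hB⟩ := hk.exists_bound
  obtain ⟨C, hC⟩ := (isCompact_Icc (a := -(B * ∫ y, |f y|)) (b := B * ∫ y, |f y|)
    ).exists_bound_of_continuousOn hp.continuousOn
  exact hg.bdd_mul (hp.comp (continuous_mollify hk hf)).aestronglyMeasurable
    (Eventually.of_forall fun x => hC _ (abs_le.1 (abs_mollify_le hB hf x)))

/-- Integration by parts against `p(U)`. Two kernels are allowed so that the same identity serves
the Laplacian (`κ` a derivative of `k`, `g = f`) and the convection term (`κ = k`). As `p(U)` is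
bounded, `p 0 = 0` is not needed. -/
theorem integral_comp_mollify_mul_fderiv {p q : ℝ → ℝ} (hp : ∀ s, HasDerivAt p (q s) s)
    (hq : Continuous q) {k κ f g : E → ℝ} (hk : IsBump k) (hκ : IsBump κ) (hf : Integrable f)
    (hg : Integrable g) (e : E) :
    ∫ x, p (mollify k f x) * mollify (fun z => fderiv ℝ κ z e) g x =
      -∫ x, q (mollify k f x) * (mollify (fun z => fderiv ℝ k z e) f x * mollify κ g x) := by
  have hpc : Continuous p := continuous_iff_continuousAt.2 fun s => (hp s).continuousAt
  obtain ⟨B, -, hB⟩ := hκ.exists_bound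
  have hgk : Integrable fun x => mollify (fun z => fderiv ℝ k z e) f x * mollify κ g x :=
    (integrable_mollify (hk.fderiv_apply e) hf).mul_bdd
      (continuous_mollify hκ hg).aestronglyMeasurable
      (Eventually.of_forall fun x => abs_mollify_le hB hg x)
  have hd : Differentiable ℝ fun x => p (mollify k f x) := fun x =>
    ((hp (mollify k f x)).comp_hasFDerivAt x
      (differentiable_mollify hk hf x).hasFDerivAt).differentiableAt
  have h := integral_mul_fderiv_eq_neg_fderiv_mul_of_integrable (μ := (volume : Measure E))
    (f := fun x => p (mollify k f x)) (g := mollify κ g) (v := e) ?_ ?_ ?_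
    (fun x _ => hd x) (fun x _ => differentiable_mollify hκ hg x)
  · simp_rw [fderiv_mollify_apply hκ hg, fderiv_comp_mollify_apply hp hk hf, mul_assoc] at h
    exact h
  · simp_rw [fderiv_comp_mollify_apply hp hk hf, mul_assoc]
    exact integrable_comp_mollify_mul hq hk hf hgk
  · simp_rw [fderiv_mollify_apply hκ hg]
    exact integrable_comp_mollify_mul hpc hk hf (integrable_mollify (hκ.fderiv_apply e) hg)
  · exact integrable_comp_mollify_mul hpc hk hf (integrable_mollify hκ hg)

/-- The integrand is the derivative of `P(U)` for a primitive `P` of `q`. Normalising `P 0 = 0`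
gives `|P(U)| ≤ C |U|`, so `P(U)` is integrable and there is no contribution from infinity. -/
theorem integral_comp_mollify_mul_fderiv_self {q : ℝ → ℝ} (hq : Continuous q)
    {k f : E → ℝ} (hk : IsBump k) (hf : Integrable f) (e : E) :
    ∫ x, q (mollify k f x) * mollify (fun z => fderiv ℝ k z e) f x = 0 := by
  set P : ℝ → ℝ := fun s => ∫ t in (0 : ℝ)..s, q t with hP
  have hPd : ∀ s, HasDerivAt P (q s) s := fun s => hq.integral_hasStrictDerivAt 0 s |>.hasDerivAt
  obtain ⟨B, -, hB⟩ := hk.exists_bound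
  set R := B * ∫ y, |f y| with hR
  obtain ⟨C, hC⟩ := (isCompact_Icc (a := -R) (b := R)).exists_bound_of_continuousOn hq.continuousOn
  have hUR : ∀ x, mollify k f x ∈ Icc (-R) R := fun x => abs_le.1 (abs_mollify_le hB hf x)
  have hPc : Continuous P := continuous_iff_continuousAt.2 fun s => (hPd s).continuousAt
  have hPi : Integrable fun x => P (mollify k f x) := by
    refine ((integrable_mollify hk hf).abs.const_mul C).mono'
      (hPc.comp (continuous_mollify hk hf)).aestronglyMeasurable (Eventually.of_forall fun x => ?_)
    have h0 : (0 : ℝ) ∈ Icc (-R) R := by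
      have := hUR x
      constructor <;> linarith [this.1, this.2]
    have := intervalIntegral.norm_integral_le_of_norm_le_const (a := (0 : ℝ))
      (b := mollify k f x) (f := q) (C := C) fun s hs =>
        hC s (uIcc_subset_Icc h0 (hUR x) (uIoc_subset_uIcc hs))
    simpa using this
  have hd : Differentiable ℝ fun x => P (mollify k f x) := fun x =>
    ((hPd (mollify k f x)).comp_hasFDerivAt x
      (differentiable_mollify hk hf x).hasFDerivAt).differentiableAt
  have h := integral_mul_fderiv_eq_neg_fderiv_mul_of_integrable (μ := (volume : Measure E))
    (f := fun _ => (1 : ℝ)) (g := fun x => P (mollify k f x)) (v := e) (by simp) ?_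
    (by simpa using hPi) (fun x _ => by fun_prop) (fun x _ => hd x)
  · simpa [fderiv_comp_mollify_apply hPd hk hf] using h
  · simpa [fderiv_comp_mollify_apply hPd hk hf] using
      integrable_comp_mollify_mul hq hk hf (integrable_mollify (hk.fderiv_apply e) hf)

theorem integrable_norm_fderiv_mollify_sq {k f : E → ℝ} (hk : IsBump k) (hf : Integrable f) :
    Integrable fun x => ‖fderiv ℝ (mollify k f) x‖ ^ 2 := by
  simp_rw [← sum_sq_apply_orthonormalBasis (stdOrthonormalBasis ℝ E),
    fderiv_mollify_apply hk hf]
  refine integrable_finsetSum _ fun i _ => ?_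
  obtain ⟨B, -, hB⟩ := (hk.fderiv_apply (stdOrthonormalBasis ℝ E i)).exists_bound
  exact integrable_sq (integrable_mollify (hk.fderiv_apply _) hf) (abs_mollify_le hB hf)

/-- Energy dissipation for the mollified equation: the convection term only contributes through the
commutator `k ∗ F(f) - F(k ∗ f)`. -/
theorem integral_comp_mollify_mul_rhs_le {p q F : ℝ → ℝ} (hp : ∀ s, HasDerivAt p (q s) s)
    (hq : Continuous q) (hq0 : ∀ s, 0 ≤ q s) (hF : Continuous F) {k f g : E → ℝ}
    (hk : IsMollifier k) (hf : Integrable f) (hg : Integrable g) {M L : ℝ}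
    (hM : ∀ x, |f x| ≤ M) (hL : ∀ s, |s| ≤ M → q s ≤ L) (a : E)
    (hE : Integrable fun x => (mollify k g x - F (mollify k f x)) ^ 2) :
    ∫ x, p (mollify k f x) * mollifiedRHS a k f g x ≤
      -(1 / 2) * (∫ x, q (mollify k f x) * ‖fderiv ℝ (mollify k f) x‖ ^ 2)
        + L * ‖a‖ ^ 2 / 2 * ∫ x, (mollify k g x - F (mollify k f x)) ^ 2 := by
  have hkb := hk.toIsBump
  have hpc : Continuous p := continuous_iff_continuousAt.2 fun s => (hp s).continuousAt
  set U := mollify k f with hU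
  set b := stdOrthonormalBasis ℝ E with hb
  have hDi := integrable_norm_fderiv_mollify_sq hkb hf
  have hD : Integrable fun x => q (U x) * ‖fderiv ℝ U x‖ ^ 2 :=
    integrable_comp_mollify_mul hq hkb hf hDi
  have hda : Integrable (mollify (fun z => fderiv ℝ k z a) f) :=
    integrable_mollify (hkb.fderiv_apply a) hf
  have hqH : Integrable fun x => q (U x) * (mollify (fun z => fderiv ℝ k z a) f x *
      mollify k g x) := by
    obtain ⟨B, -, hB⟩ := hkb.exists_bound
    exact integrable_comp_mollify_mul hq hkb hf
      (hda.mul_bdd (continuous_mollify hkb hg).aestronglyMeasurable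
        (Eventually.of_forall fun x => abs_mollify_le hB hg x))
  have hqF : Integrable fun x => (q (U x) * F (U x)) * mollify (fun z => fderiv ℝ k z a) f x :=
    integrable_comp_mollify_mul (p := fun s => q s * F s) (hq.mul hF) hkb hf hda
  have hlap : ∫ x, p (U x) * ∑ i, mollify (fun z => fderiv ℝ (fun w => fderiv ℝ k w (b i)) z
      (b i)) f x = -∫ x, q (U x) * ‖fderiv ℝ U x‖ ^ 2 := by
    simp_rw [Finset.mul_sum]
    rw [integral_finsetSum _ fun i _ => integrable_comp_mollify_mul hpc hkb hf
      (integrable_mollify ((hkb.fderiv_apply _).fderiv_apply _) hf)]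
    simp_rw [hU, integral_comp_mollify_mul_fderiv hp hq hkb (hkb.fderiv_apply (b _)) hf hf (b _),
      ← sum_sq_apply_orthonormalBasis b, Finset.mul_sum]
    rw [integral_finsetSum]
    · simp_rw [fderiv_mollify_apply hkb hf, sq, Finset.sum_neg_distrib]
    · intro i _
      obtain ⟨B, -, hB⟩ := (hkb.fderiv_apply (b i)).exists_bound
      simp_rw [fderiv_mollify_apply hkb hf]
      exact integrable_comp_mollify_mul hq hkb hf
        (integrable_sq (integrable_mollify (hkb.fderiv_apply _) hf) (abs_mollify_le hB hf))
  -- After integration by parts, subtract the vanishing integral of `q(U) F(U) ∂ₐU`; what remains is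
  -- the commutator.
  have hconv : ∫ x, p (U x) * mollify (fun z => fderiv ℝ k z a) g x =
      -∫ x, q (U x) * mollify (fun z => fderiv ℝ k z a) f x * (mollify k g x - F (U x)) := by
    rw [hU, integral_comp_mollify_mul_fderiv hp hq hkb hkb hf hg a]
    have h0 := integral_comp_mollify_mul_fderiv_self (q := fun s => q s * F s) (hq.mul hF) hkb hf a
    have : ∀ x, q (U x) * mollify (fun z => fderiv ℝ k z a) f x * (mollify k g x - F (U x))
        = q (U x) * (mollify (fun z => fderiv ℝ k z a) f x * mollify k g x)
          - (q (U x) * F (U x)) * mollify (fun z => fderiv ℝ k z a) f x := fun x => by ring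
    simp_rw [← hU, this]
    rw [integral_sub hqH hqF, h0, sub_zero]
  have hconv_le : -∫ x, q (U x) * mollify (fun z => fderiv ℝ k z a) f x *
      (mollify k g x - F (U x)) ≤
      (1 / 2) * (∫ x, q (U x) * ‖fderiv ℝ U x‖ ^ 2)
        + L * ‖a‖ ^ 2 / 2 * ∫ x, (mollify k g x - F (U x)) ^ 2 := by
    rw [← integral_neg, ← integral_const_mul, ← integral_const_mul,
      ← integral_add (hD.const_mul _) (hE.const_mul _)]
    refine integral_mono ?_ ((hD.const_mul _).add (hE.const_mul _)) fun x => ?_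
    · refine ((hqH.sub hqF).neg).congr (Eventually.of_forall fun x => ?_)
      simp only [Pi.neg_apply, Pi.sub_apply]
      ring
    · simp only
      have h1 : |mollify (fun z => fderiv ℝ k z a) f x| ≤ ‖fderiv ℝ U x‖ * ‖a‖ := by
        rw [← fderiv_mollify_apply hkb hf]
        exact (fderiv ℝ U x).le_opNorm a
      have h2 := hL (U x) (hk.abs_mollify_le hM x)
      have h3 := hq0 (U x)
      set D := mollify (fun z => fderiv ℝ k z a) f x
      set e := mollify k g x - F (U x)
      set n := ‖fderiv ℝ U x‖
      have h4 : -(D * e) ≤ n * (‖a‖ * |e|) := by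
        calc -(D * e) ≤ |D * e| := neg_le_abs _
          _ = |D| * |e| := abs_mul _ _
          _ ≤ (n * ‖a‖) * |e| := mul_le_mul_of_nonneg_right h1 (abs_nonneg _)
          _ = _ := by ring
      -- Young's inequality with weights that use up exactly half of the dissipation.
      have h5 : n * (‖a‖ * |e|) ≤ n ^ 2 / 2 + ‖a‖ ^ 2 * e ^ 2 / 2 := by
        have := two_mul_le_add_sq n (‖a‖ * |e|)
        rw [mul_pow, sq_abs] at this
        linarith
      have h6 := mul_le_mul_of_nonneg_left (h4.trans h5) h3
      have h7 := mul_le_mul_of_nonneg_right h2 (show 0 ≤ ‖a‖ ^ 2 * e ^ 2 / 2 by positivity)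
      calc -(q (U x) * D * e) = q (U x) * -(D * e) := by ring
        _ ≤ q (U x) * (n ^ 2 / 2 + ‖a‖ ^ 2 * e ^ 2 / 2) := h6
        _ ≤ _ := by linarith
  have hsplit : ∫ x, p (U x) * mollifiedRHS a k f g x =
      (∫ x, p (U x) * ∑ i, mollify (fun z => fderiv ℝ (fun w => fderiv ℝ k w (b i)) z
        (b i)) f x) + ∫ x, p (U x) * mollify (fun z => fderiv ℝ k z a) g x := by
    rw [← integral_add]
    · simp only [mollifiedRHS, mul_add, hb]
    · exact integrable_comp_mollify_mul hpc hkb hf (integrable_finsetSum _ fun i _ =>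
        integrable_mollify ((hkb.fderiv_apply _).fderiv_apply _) hf)
    · exact integrable_comp_mollify_mul hpc hkb hf (integrable_mollify (hkb.fderiv_apply a) hg)
  rw [hsplit, hlap, hconv]
  linarith

end Dissipation

/-! ### From weak to classical derivatives in time. -/

/-- A function with a weak derivative on `(0, ∞)`, both continuous, is differentiable there. -/
theorem hasDerivAt_of_weak_deriv {g h : ℝ → ℝ} (hg : Continuous g) (hh : Continuous h)
    (H : ∀ χ : ℝ → ℝ, ContDiff ℝ ∞ χ → HasCompactSupport χ → tsupport χ ⊆ Ioi 0 →
      ∫ t in Ioi (0 : ℝ), (deriv χ t * g t + χ t * h t) = 0) {t : ℝ} (ht : 0 < t) :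
    HasDerivAt g (h t) t := by
  let φ : ℕ → ContDiffBump (0 : ℝ) := fun n =>
    ⟨1 / (2 * (n + 1 : ℝ)), 1 / (n + 1 : ℝ), by positivity, by
      apply one_div_lt_one_div_of_lt <;> [positivity; linarith [n.cast_nonneg (α := ℝ)]]⟩
  have hφ : Tendsto (fun n => (φ n).rOut) atTop (𝓝 0) := tendsto_one_div_add_atTop_nhds_zero_nat
  let η : ℕ → ℝ → ℝ := fun n => (φ n).normed volume
  let S : ℕ → (ℝ → ℝ) → ℝ → ℝ := fun n f =>
    convolution (η n) f (ContinuousLinearMap.lsmul ℝ ℝ) volume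
  have hsm : ∀ n, ContDiff ℝ ∞ (η n) := fun n => (φ n).contDiff_normed
  have hcs : ∀ n, HasCompactSupport (η n) := fun n => (φ n).hasCompactSupport_normed
  -- Test with the reflected bump `y ↦ η n (s - y)`. The condition `rOut < s` keeps its support
  -- inside `(0, ∞)`.
  have hder : ∀ n s, (φ n).rOut < s → HasDerivAt (S n g) (S n h s) s := by
    intro n s hs
    have h1 := (hcs n).hasDerivAt_convolution_left (ContinuousLinearMap.lsmul ℝ ℝ)
      ((hsm n).of_le (by simp)) hg.locallyIntegrable s (μ := volume)
    convert! h1 using 1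
    have hχs : ∀ y, (φ n).rOut < dist y s → η n (s - y) = 0 := by
      intro y hy
      by_contra hne
      have : s - y ∈ Function.support ((φ n).normed volume) := hne
      rw [(φ n).support_normed_eq] at this
      rw [dist_comm, Real.dist_eq] at hy
      simp only [Metric.mem_ball, dist_zero_right, Real.norm_eq_abs] at this
      linarith
    have hsub : Function.support (fun y => η n (s - y)) ⊆ Metric.closedBall s (φ n).rOut := by
      intro y hy
      by_contra hne
      exact hy (hχs y (by simpa using hne))
    have htsub : tsupport (fun y => η n (s - y)) ⊆ Metric.closedBall s (φ n).rOut :=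
      closure_minimal hsub Metric.isClosed_closedBall
    have hpos : Metric.closedBall s (φ n).rOut ⊆ Ioi 0 := by
      intro y hy
      rw [Metric.mem_closedBall, Real.dist_eq, abs_le] at hy
      simp only [mem_Ioi]
      linarith [hy.1]
    have hd : ∀ y, deriv (fun y => η n (s - y)) y = -deriv (η n) (s - y) := fun y =>
      deriv_comp_const_sub _ _ _
    have hχc : HasCompactSupport (fun y => η n (s - y)) :=
      (isCompact_closedBall s _).of_isClosed_subset (isClosed_tsupport _) htsub
    have hχsm : ContDiff ℝ ∞ (fun y => η n (s - y)) := (hsm n).comp (contDiff_const.sub contDiff_id)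
    have hH := H (fun y => η n (s - y)) hχsm hχc (htsub.trans hpos)
    have hfull : ∫ y in Ioi (0 : ℝ), (deriv (fun y => η n (s - y)) y * g y + η n (s - y) * h y)
        = ∫ y, (deriv (fun y => η n (s - y)) y * g y + η n (s - y) * h y) := by
      refine setIntegral_eq_integral_of_forall_compl_eq_zero fun y hy => ?_
      have hy' : y ∉ tsupport (fun y => η n (s - y)) := fun hmem => hy (hpos (htsub hmem))
      have e1 : deriv (fun y => η n (s - y)) y = 0 := by
        by_contra hne
        exact hy' (support_deriv_subset hne)
      have e2 : η n (s - y) = 0 := by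
        by_contra hne
        exact hy' (subset_tsupport _ hne)
      rw [e1, e2, zero_mul, zero_mul, add_zero]
    rw [hfull] at hH
    have i1 : Integrable fun y => deriv (fun y => η n (s - y)) y * g y :=
      ((hχsm.continuous_deriv (by simp)).mul hg).integrable_of_hasCompactSupport
        (hχc.deriv.mul_right)
    have i2 : Integrable fun y => η n (s - y) * h y :=
      (hχsm.continuous.mul hh).integrable_of_hasCompactSupport hχc.mul_right
    rw [integral_add i1 i2] at hH
    simp_rw [hd, neg_mul] at hH
    rw [integral_neg] at hH
    have eS : S n h s = ∫ y, η n (s - y) * h y := by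
      simp only [S]
      rw [convolution_eq_swap]
      rfl
    have eD : convolution (deriv (η n)) g (ContinuousLinearMap.lsmul ℝ ℝ) volume s
        = ∫ y, deriv (η n) (s - y) * g y := by
      rw [convolution_eq_swap]
      rfl
    rw [eS, eD]
    linarith
  -- The regularised functions converge pointwise and their derivatives converge uniformly near `t`,
  -- so the derivative passes to the limit.
  refine hasDerivAt_of_tendstoUniformlyOnFilter (l := atTop) (f := fun n => S n g)
    (f' := fun n => S n h) (g' := h) ?_ ?_ ?_
  · rw [Metric.tendstoUniformlyOnFilter_iff]
    intro ε hε
    obtain ⟨r, hr, hhr⟩ := Metric.continuousAt_iff.1 (hh.continuousAt (x := t)) (ε / 4)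
      (by positivity)
    have e1 : ∀ᶠ n in atTop, (φ n).rOut < r / 2 := hφ.eventually_lt_const (by positivity)
    have e2 : ∀ᶠ s in 𝓝 t, dist s t < r / 2 := Metric.ball_mem_nhds t (by positivity)
    filter_upwards [e1.prod_mk e2] with p hp
    rw [dist_comm]
    refine lt_of_le_of_lt ((φ p.1).dist_normed_convolution_le (ε := ε / 2)
      hh.aestronglyMeasurable fun y hy => ?_) (by linarith)
    have hy1 : dist y t < r := by
      have := dist_triangle y p.2 t
      rw [Metric.mem_ball] at hy
      linarith [hp.1, hp.2]
    have := dist_triangle_right (h y) (h p.2) (h t)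
    linarith [hhr hy1, hhr (x := p.2) (by linarith [hp.2])]
  · have e1 : ∀ᶠ n in atTop, (φ n).rOut < t / 2 := hφ.eventually_lt_const (by positivity)
    have e2 : ∀ᶠ s in 𝓝 t, t / 2 < s := lt_mem_nhds (by linarith)
    filter_upwards [e1.prod_mk e2] with p hp
    exact hder p.1 p.2 (hp.1.trans hp.2)
  · exact Eventually.of_forall fun s =>
      ContDiffBump.convolution_tendsto_right_of_continuous hφ hg s

/-! ### Bounded curves continuous into `L¹`. -/

/-- Curves that are continuous into `L¹` and uniformly bounded. -/
structure IsBoundedL1Curve {E : Type*} [MeasureSpace E] (v : ℝ → E → ℝ) (M : ℝ) : Prop where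
  measurable : ∀ t, Measurable (v t)
  integrable : ∀ t, Integrable (v t)
  abs_le : ∀ t x, |v t x| ≤ M
  tendsto : ∀ t, Tendsto (fun s => ∫ x, |v s x - v t x|) (𝓝 t) (𝓝 0)

section Curve

variable {E : Type*} [NormedAddCommGroup E] [InnerProductSpace ℝ E] [FiniteDimensional ℝ E]
  [MeasurableSpace E] [BorelSpace E]

theorem IsBoundedL1Curve.nonneg {v : ℝ → E → ℝ} {M : ℝ} (hv : IsBoundedL1Curve v M) : 0 ≤ M :=
  (abs_nonneg _).trans (hv.abs_le 0 0)

theorem IsBoundedL1Curve.comp {v : ℝ → E → ℝ} {M : ℝ} (hv : IsBoundedL1Curve v M) {F : ℝ → ℝ}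
    (hF : Continuous F) (hF0 : F 0 = 0) {K : ℝ}
    (hK : ∀ x y, |x| ≤ M → |y| ≤ M → |F x - F y| ≤ K * |x - y|) (hK0 : 0 ≤ K) :
    IsBoundedL1Curve (fun t x => F (v t x)) (K * M) := by
  have hb : ∀ t x, |F (v t x)| ≤ K * |v t x| := fun t x => by
    simpa [hF0] using hK (v t x) 0 (hv.abs_le t x) (by simpa using hv.nonneg)
  have hi : ∀ t, Integrable (fun x => F (v t x)) := fun t =>
    ((hv.integrable t).abs.const_mul K).mono'
      (hF.measurable.comp (hv.measurable t)).aestronglyMeasurable (Eventually.of_forall (hb t))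
  refine ⟨fun t => hF.measurable.comp (hv.measurable t), hi, fun t x =>
    (hb t x).trans (mul_le_mul_of_nonneg_left (hv.abs_le t x) hK0), fun t => ?_⟩
  have h := (hv.tendsto t).const_mul K
  rw [mul_zero] at h
  refine squeeze_zero (fun s => integral_nonneg fun x => abs_nonneg _) (fun s => ?_) h
  rw [← integral_const_mul]
  exact integral_mono ((hi s).sub (hi t)).abs
    (((hv.integrable s).sub (hv.integrable t)).abs.const_mul K)
    fun x => hK _ _ (hv.abs_le s x) (hv.abs_le t x)

/-- A bounded kernel turns `L¹` closeness of `v s` and `v t` into uniform closeness of their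
mollifications, hence joint continuity in time and space. -/
theorem IsBoundedL1Curve.continuous_mollify {v : ℝ → E → ℝ} {M : ℝ} (hv : IsBoundedL1Curve v M)
    {k : E → ℝ} (hk : IsBump k) : Continuous fun p : ℝ × E => mollify k (v p.1) p.2 := by
  obtain ⟨B, hB0, hB⟩ := hk.exists_bound
  refine continuous_iff_continuousAt.2 fun ⟨t, x⟩ => ?_
  have h1 : Tendsto (fun p : ℝ × E => mollify k (fun y => v p.1 y - v t y) p.2)
      (𝓝 (t, x)) (𝓝 0) := by
    have h := ((hv.tendsto t).comp (continuous_fst.tendsto (t, x))).const_mul B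
    rw [mul_zero] at h
    exact squeeze_zero_norm (fun p => abs_mollify_le hB
      ((hv.integrable p.1).sub (hv.integrable t)) p.2) h
  have h2 : Tendsto (fun p : ℝ × E => mollify k (v t) p.2) (𝓝 (t, x)) (𝓝 (mollify k (v t) x)) :=
    ((_root_.continuous_mollify hk (hv.integrable t)).comp continuous_snd).tendsto (t, x)
  have h3 := h1.add h2
  rw [zero_add] at h3
  refine h3.congr fun p => ?_
  rw [mollify_sub hk (hv.integrable p.1) (hv.integrable t)]
  ring

theorem IsBoundedL1Curve.continuous_mollify_left {v : ℝ → E → ℝ} {M : ℝ}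
    (hv : IsBoundedL1Curve v M) {k : E → ℝ} (hk : IsBump k) (x : E) :
    Continuous fun t => mollify k (v t) x :=
  (hv.continuous_mollify hk).comp (by fun_prop : Continuous fun t : ℝ => (t, x))

theorem IsBoundedL1Curve.continuous_mollifiedRHS {v w : ℝ → E → ℝ} {M M' : ℝ}
    (hv : IsBoundedL1Curve v M) (hw : IsBoundedL1Curve w M') {k : E → ℝ} (hk : IsBump k) (a : E) :
    Continuous fun p : ℝ × E => mollifiedRHS a k (v p.1) (w p.1) p.2 :=
  (continuous_finsetSum _ fun _ _ =>
    hv.continuous_mollify ((hk.fderiv_apply _).fderiv_apply _)).add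
    (hw.continuous_mollify (hk.fderiv_apply a))

theorem IsBoundedL1Curve.continuous_integral_abs {v : ℝ → E → ℝ} {M : ℝ}
    (hv : IsBoundedL1Curve v M) : Continuous fun t => ∫ x, |v t x| := by
  refine continuous_iff_continuousAt.2 fun t => tendsto_iff_dist_tendsto_zero.2 ?_
  refine squeeze_zero (fun _ => dist_nonneg) (fun s => ?_) (hv.tendsto t)
  rw [Real.dist_eq, ← integral_sub (hv.integrable s).abs (hv.integrable t).abs]
  refine abs_integral_le_integral_abs.trans (integral_mono
    ((hv.integrable s).abs.sub (hv.integrable t).abs).abs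
    ((hv.integrable s).sub (hv.integrable t)).abs fun x => ?_)
  exact abs_abs_sub_abs_le_abs_sub _ _

end Curve

/-! ### The mollified equation holds pointwise. -/

section Weak

theorem laplacian_eq_sum_fderiv_fderiv {E : Type*} [NormedAddCommGroup E] [InnerProductSpace ℝ E]
    [FiniteDimensional ℝ E] {f : E → ℝ} (hf : ContDiff ℝ ∞ f) (x : E) :
    Laplacian.laplacian f x = ∑ i, fderiv ℝ (fun w => fderiv ℝ f w (stdOrthonormalBasis ℝ E i)) x
      (stdOrthonormalBasis ℝ E i) := by
  rw [InnerProductSpace.laplacian_eq_iteratedFDeriv_stdOrthonormalBasis]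
  refine Finset.sum_congr rfl fun i _ => ?_
  rw [iteratedFDeriv_two_apply]
  have hd : DifferentiableAt ℝ (fderiv ℝ f) x :=
    ((hf.fderiv_right (m := ∞) (by simp)).differentiable (by simp)) x
  rw [fderiv_clm_apply hd (differentiableAt_const _)]
  simp

theorem fderiv_const_mul_comp_sub {E : Type*} [NormedAddCommGroup E] [NormedSpace ℝ E]
    {k : E → ℝ} (hk : Differentiable ℝ k) (c : ℝ) (x y e : E) :
    fderiv ℝ (fun y => c * k (x - y)) y e = -c * fderiv ℝ k (x - y) e := by
  have h1 : HasFDerivAt (fun y => x - y) (-ContinuousLinearMap.id ℝ E) y := by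
    simpa using (hasFDerivAt_id (𝕜 := ℝ) y).const_sub x
  have h2 := (((hk (x - y)).hasFDerivAt.comp y h1).const_mul c).fderiv
  have h3 : fderiv ℝ (fun y => c * k (x - y)) y =
    c • (fderiv ℝ k (x - y)).comp (-ContinuousLinearMap.id ℝ E) := h2
  rw [h3]
  simp

variable {N : ℕ}

theorem isParabolicTest_mul {χ : ℝ → ℝ} (hχ : ContDiff ℝ ∞ χ) (hχc : HasCompactSupport χ)
    (hχ0 : tsupport χ ⊆ Ioi 0) {k : EuclideanSpace ℝ (Fin N) → ℝ} (hk : IsBump k)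
    (x : EuclideanSpace ℝ (Fin N)) : IsParabolicTest (fun s y => χ s * k (x - y)) where
  smooth := (hχ.comp contDiff_fst).mul (hk.smooth.comp (contDiff_const.sub contDiff_snd))
  compact_support := by
    refine HasCompactSupport.intro
      (hχc.isCompact.prod (hk.compact.isCompact.image (continuous_sub_left x))) fun p hp => ?_
    by_contra hne
    obtain ⟨h1, h2⟩ := mul_ne_zero_iff.1 hne
    exact hp ⟨subset_tsupport _ h1, x - p.2, subset_tsupport _ h2, by simp⟩
  support_pos := by
    have : tsupport (Function.uncurry fun s y => χ s * k (x - y)) ⊆ tsupport χ ×ˢ univ := by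
      refine closure_minimal (fun p hp => ?_) ((isClosed_tsupport χ).prod isClosed_univ)
      exact ⟨subset_tsupport _ (mul_ne_zero_iff.1 hp).1, mem_univ _⟩
    exact this.trans (prod_mono hχ0 le_rfl)

/-- The mollification in space of a weak solution solves the mollified equation pointwise. -/
theorem hasDerivAt_mollify_of_weak {a : EuclideanSpace ℝ (Fin N)} {F : ℝ → ℝ}
    {v : ℝ → EuclideanSpace ℝ (Fin N) → ℝ} {M M' : ℝ} (hv : IsBoundedL1Curve v M)
    (hFv : IsBoundedL1Curve (fun t x => F (v t x)) M')
    (heq : ∀ φ : ℝ → EuclideanSpace ℝ (Fin N) → ℝ, IsParabolicTest φ →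
      ∫ t in Ioi (0 : ℝ), ∫ x, v t x *
        (deriv (fun s => φ s x) t + Laplacian.laplacian (φ t) x) =
      ∫ t in Ioi (0 : ℝ), ∫ x, F (v t x) * fderiv ℝ (φ t) x a)
    {k : EuclideanSpace ℝ (Fin N) → ℝ} (hk : IsBump k) (x : EuclideanSpace ℝ (Fin N))
    {t : ℝ} (ht : 0 < t) :
    HasDerivAt (fun s => mollify k (v s) x)
      (mollifiedRHS a k (v t) (fun x => F (v t x)) x) t := by
  have hhc : Continuous fun s => mollifiedRHS a k (v s) (fun x => F (v s x)) x :=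
    (hv.continuous_mollifiedRHS hFv hk a).comp (by fun_prop : Continuous fun t : ℝ => (t, x))
  refine hasDerivAt_of_weak_deriv
    (h := fun s => mollifiedRHS a k (v s) (fun x => F (v s x)) x)
    (hv.continuous_mollify_left hk x) hhc (fun χ hχ hχc hχ0 => ?_) ht
  set b := stdOrthonormalBasis ℝ (EuclideanSpace ℝ (Fin N)) with hb
  have hkd : Differentiable ℝ k := hk.smooth.differentiable (by simp)
  -- For the test function `χ(s) k(x - y)` each spatial integral is a mollification evaluated at
  -- `x`. Reflecting `y` changes the sign of the gradient but not of the Laplacian.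
  have h := heq _ (isParabolicTest_mul hχ hχc hχ0 hk x)
  have hlap : ∀ s y, Laplacian.laplacian (fun y => χ s * k (x - y)) y =
      ∑ i, χ s * fderiv ℝ (fun w => fderiv ℝ k w (b i)) (x - y) (b i) := by
    intro s y
    have hsm : ContDiff ℝ ∞ fun y => χ s * k (x - y) :=
      contDiff_const.mul (hk.smooth.comp (contDiff_const.sub contDiff_id))
    rw [laplacian_eq_sum_fderiv_fderiv hsm]
    refine Finset.sum_congr rfl fun i _ => ?_
    simp_rw [fderiv_const_mul_comp_sub hkd, ← hb]
    rw [fderiv_const_mul_comp_sub ((hk.fderiv_apply (b i)).smooth.differentiable (by simp)),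
      neg_neg]
  have hder : ∀ s y, deriv (fun s => χ s * k (x - y)) s = deriv χ s * k (x - y) := fun s y =>
    deriv_mul_const ((hχ.differentiable (by simp)) s) _
  have hL : ∀ s, ∫ y, v s y * (deriv (fun s => χ s * k (x - y)) s
      + Laplacian.laplacian (fun y => χ s * k (x - y)) y) = deriv χ s * mollify k (v s) x
      + χ s * ∑ i, mollify (fun z => fderiv ℝ (fun w => fderiv ℝ k w (b i)) z (b i)) (v s) x := by
    intro s
    have hbi := fun i => (hk.fderiv_apply (b i)).fderiv_apply (b i)
    have i1 := (integrable_mul_bump hk (hv.integrable s) x).const_mul (deriv χ s)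
    have i2 := fun i => (integrable_mul_bump (hbi i) (hv.integrable s) x)
    have e : ∀ y, v s y * (deriv χ s * k (x - y)
        + ∑ i, χ s * fderiv ℝ (fun w => fderiv ℝ k w (b i)) (x - y) (b i))
        = deriv χ s * (v s y * k (x - y)) + χ s * ∑ i, v s y *
          fderiv ℝ (fun w => fderiv ℝ k w (b i)) (x - y) (b i) := by
      intro y
      rw [mul_add, ← Finset.mul_sum, ← Finset.mul_sum]
      ring
    simp_rw [hder, hlap, e]
    rw [integral_add i1 ((integrable_finsetSum _ fun i _ => i2 i).const_mul _),
      integral_const_mul, integral_const_mul, integral_finsetSum _ fun i _ => i2 i]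
    rfl
  have hR : ∀ s, ∫ y, F (v s y) * fderiv ℝ (fun y => χ s * k (x - y)) y a
      = -(χ s * mollify (fun z => fderiv ℝ k z a) (fun x => F (v s x)) x) := by
    intro s
    simp_rw [fderiv_const_mul_comp_sub hkd]
    rw [mollify, ← integral_const_mul, ← integral_neg]
    congr 1
    ext y
    ring
  simp_rw [hL, hR] at h
  have hc1 := hv.continuous_mollify_left hk x
  have hc2 : Continuous fun s => ∑ i, mollify
      (fun z => fderiv ℝ (fun w => fderiv ℝ k w (b i)) z (b i)) (v s) x :=
    continuous_finsetSum _ fun i _ =>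
      hv.continuous_mollify_left ((hk.fderiv_apply _).fderiv_apply _) x
  have hc3 := hFv.continuous_mollify_left (hk.fderiv_apply a) x
  have j1 : IntegrableOn (fun s => deriv χ s * mollify k (v s) x + χ s * ∑ i, mollify
      (fun z => fderiv ℝ (fun w => fderiv ℝ k w (b i)) z (b i)) (v s) x) (Ioi 0) :=
    ((((hχ.continuous_deriv (by simp)).mul hc1).integrable_of_hasCompactSupport
      hχc.deriv.mul_right).add ((hχ.continuous.mul hc2).integrable_of_hasCompactSupport
      hχc.mul_right)).integrableOn
  have j2 : IntegrableOn (fun s => χ s * mollify (fun z => fderiv ℝ k z a)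
      (fun x => F (v s x)) x) (Ioi 0) :=
    ((hχ.continuous.mul hc3).integrable_of_hasCompactSupport hχc.mul_right).integrableOn
  rw [integral_neg, ← add_eq_zero_iff_eq_neg, ← integral_add j1 j2] at h
  refine (integral_congr_ae (Eventually.of_forall fun s => ?_)).trans h
  simp only [mollifiedRHS, hb]
  ring

end Weak

/-! ### Weighted energy inequalities and removal of the mollification. -/

/-- A bounded `L¹`-continuous curve all of whose mollifications solve the mollified equation
`∂ₜ(k ∗ v) = Δ(k ∗ v) + a·∇(k ∗ F(v))`, where `F` has Lipschitz constant `K` on the range. -/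
structure IsMollifiedSolution {E : Type*} [NormedAddCommGroup E] [InnerProductSpace ℝ E]
    [FiniteDimensional ℝ E] [MeasurableSpace E] [BorelSpace E] (a : E) (F : ℝ → ℝ)
    (v : ℝ → E → ℝ) (M K : ℝ) : Prop where
  curve : IsBoundedL1Curve v M
  continuous_flux : Continuous F
  flux_zero : F 0 = 0
  lipschitz_nonneg : 0 ≤ K
  lipschitz : ∀ x y, |x| ≤ M → |y| ≤ M → |F x - F y| ≤ K * |x - y|
  hasDerivAt : ∀ k : E → ℝ, IsBump k → ∀ x t, 0 < t → HasDerivAt (fun s => mollify k (v s) x)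
    (mollifiedRHS a k (v t) (fun x => F (v t x)) x) t

theorem exists_lipschitz_bound {J p : ℝ → ℝ} (hJ : ∀ s, HasDerivAt J (p s) s) (hp : Continuous p)
    (M : ℝ) : ∃ C, 0 ≤ C ∧ (∀ x, |x| ≤ M → |p x| ≤ C) ∧
      ∀ x y, |x| ≤ M → |y| ≤ M → |J x - J y| ≤ C * |x - y| := by
  obtain ⟨C, hC⟩ := (isCompact_Icc (a := -M) (b := M)).exists_bound_of_continuousOn hp.continuousOn
  refine ⟨max C 0, le_max_right _ _, fun x hx => (hC x (abs_le.1 hx)).trans (le_max_left _ _),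
    fun x y hx hy => ?_⟩
  exact Convex.norm_image_sub_le_of_norm_hasDerivWithin_le
    (fun s _ => (hJ s).hasDerivWithinAt) (fun s hs => (hC s hs).trans (le_max_left _ _))
    (convex_Icc (-M) M) (abs_le.1 hy) (abs_le.1 hx)

section Energy

variable {E : Type*} [NormedAddCommGroup E] [InnerProductSpace ℝ E] [FiniteDimensional ℝ E]
  [MeasurableSpace E] [BorelSpace E]

/-- Supplies the locally bounded majorant in time that justifies Fubini in `energy_identity`. -/
theorem exists_integral_abs_mollifiedRHS_le (a : E) {k : E → ℝ} (hk : IsBump k) :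
    ∃ C, 0 ≤ C ∧ ∀ f g : E → ℝ, Integrable f → Integrable g →
      ∫ x, |mollifiedRHS a k f g x| ≤ C * (∫ x, |f x|) + C * ∫ x, |g x| := by
  set b := stdOrthonormalBasis ℝ E with hb
  set c : Fin (Module.finrank ℝ E) → ℝ := fun i =>
    ∫ x, |fderiv ℝ (fun w => fderiv ℝ k w (b i)) x (b i)| with hc
  set d := ∫ x, |fderiv ℝ k x a| with hd
  have hc0 : ∀ i, 0 ≤ c i := fun i => integral_nonneg fun x => abs_nonneg _
  have hd0 : 0 ≤ d := integral_nonneg fun x => abs_nonneg _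
  have hs0 : 0 ≤ ∑ i, c i := Finset.sum_nonneg fun i _ => hc0 i
  refine ⟨∑ i, c i + d, by positivity, fun f g hf hg => ?_⟩
  have hki := fun i => (hk.fderiv_apply (b i)).fderiv_apply (b i)
  have i1 := fun i => (integrable_mollify (hki i) hf).abs
  have i2 := (integrable_mollify (hk.fderiv_apply a) hg).abs
  have hsum : Integrable fun x => ∑ i, |mollify
      (fun z => fderiv ℝ (fun w => fderiv ℝ k w (b i)) z (b i)) f x| :=
    integrable_finsetSum _ fun i _ => i1 i
  have h1 : ∫ x, |mollifiedRHS a k f g x| ≤ ∑ i, (∫ x, |f x|) * c i + (∫ x, |g x|) * d := by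
    calc ∫ x, |mollifiedRHS a k f g x| ≤ ∫ x, (∑ i, |mollify
          (fun z => fderiv ℝ (fun w => fderiv ℝ k w (b i)) z (b i)) f x|
          + |mollify (fun z => fderiv ℝ k z a) g x|) := by
          refine integral_mono (integrable_mollifiedRHS a hk hf hg).abs (hsum.add i2) fun x => ?_
          exact (abs_add_le _ _).trans (add_le_add (Finset.abs_sum_le_sum_abs _ _) le_rfl)
      _ ≤ _ := by
          rw [integral_add hsum i2, integral_finsetSum _ fun i _ => i1 i]
          exact add_le_add (Finset.sum_le_sum fun i _ => integral_abs_mollify_le (hki i) hf)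
            (integral_abs_mollify_le (hk.fderiv_apply a) hg)
  rw [← Finset.mul_sum] at h1
  have hf0 : 0 ≤ ∫ x, |f x| := integral_nonneg fun x => abs_nonneg _
  have hg0 : 0 ≤ ∫ x, |g x| := integral_nonneg fun x => abs_nonneg _
  nlinarith [mul_nonneg hf0 hd0, mul_nonneg hg0 hs0]

namespace IsMollifiedSolution

variable {a : E} {F : ℝ → ℝ} {v : ℝ → E → ℝ} {M K : ℝ}

theorem flux_curve (h : IsMollifiedSolution a F v M K) :
    IsBoundedL1Curve (fun t x => F (v t x)) (K * M) :=
  h.curve.comp h.continuous_flux h.flux_zero h.lipschitz h.lipschitz_nonneg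

theorem integrable_comp_mollify (h : IsMollifiedSolution a F v M K) {k : E → ℝ}
    (hk : IsMollifier k) {J : ℝ → ℝ} (hJ : Continuous J) {C : ℝ}
    (hC : ∀ x, |x| ≤ M → |J x| ≤ C * |x|) (t : ℝ) :
    Integrable fun x => J (mollify k (v t) x) :=
  ((integrable_mollify hk.toIsBump (h.curve.integrable t)).abs.const_mul C).mono'
    (hJ.comp (continuous_mollify hk.toIsBump (h.curve.integrable t))).aestronglyMeasurable
    (Eventually.of_forall fun x => hC _ (hk.abs_mollify_le (h.curve.abs_le t) x))

/-- For fixed `x`, apply the fundamental theorem of calculus to `w J(U)` in time, then integrate in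
`x` and exchange the integrals. The equation is used only at positive times; continuity reaches `0`.
-/
theorem energy_identity (h : IsMollifiedSolution a F v M K) {k : E → ℝ} (hk : IsMollifier k)
    {J p : ℝ → ℝ} (hJ : ∀ s, HasDerivAt J (p s) s) (hp : Continuous p) (hJ0 : J 0 = 0)
    {w w' : ℝ → ℝ} (hw : ∀ s, HasDerivAt w (w' s) s) (hw' : Continuous w') {t : ℝ} (ht : 0 ≤ t) :
    IntegrableOn (fun τ => w' τ * (∫ x, J (mollify k (v τ) x)) + w τ *
      ∫ x, p (mollify k (v τ) x) * mollifiedRHS a k (v τ) (fun x => F (v τ x)) x) (Ioc 0 t) ∧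
    w t * (∫ x, J (mollify k (v t) x)) - w 0 * (∫ x, J (mollify k (v 0) x)) =
      ∫ τ in Ioc 0 t, (w' τ * (∫ x, J (mollify k (v τ) x)) + w τ *
        ∫ x, p (mollify k (v τ) x) * mollifiedRHS a k (v τ) (fun x => F (v τ x)) x) := by
  have hkb := hk.toIsBump
  have hJc : Continuous J := continuous_iff_continuousAt.2 fun s => (hJ s).continuousAt
  have hwc : Continuous w := continuous_iff_continuousAt.2 fun s => (hw s).continuousAt
  set U : ℝ → E → ℝ := fun τ => mollify k (v τ) with hU
  set R : ℝ → E → ℝ := fun τ => mollifiedRHS a k (v τ) (fun x => F (v τ x)) with hR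
  obtain ⟨C, hC0, hpC, hJC⟩ := exists_lipschitz_bound hJ hp M
  have hM0 := h.curve.nonneg
  have hJC' : ∀ x, |x| ≤ M → |J x| ≤ C * |x| := fun x hx => by
    simpa [hJ0] using hJC x 0 hx (by simpa using hM0)
  obtain ⟨D, hD0, hD⟩ := exists_integral_abs_mollifiedRHS_le a hkb
  have hUM : ∀ τ x, |U τ x| ≤ M := fun τ => hk.abs_mollify_le (h.curve.abs_le τ)
  have hUi : ∀ τ, Integrable (U τ) := fun τ => integrable_mollify hkb (h.curve.integrable τ)
  have hRi : ∀ τ, Integrable (R τ) := fun τ =>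
    integrable_mollifiedRHS a hkb (h.curve.integrable τ) (h.flux_curve.integrable τ)
  have hUc : Continuous fun q : ℝ × E => U q.1 q.2 := h.curve.continuous_mollify hkb
  have hRc : Continuous fun q : ℝ × E => R q.1 q.2 :=
    h.curve.continuous_mollifiedRHS h.flux_curve hkb a
  have hJi : ∀ τ, Integrable fun x => J (U τ x) := h.integrable_comp_mollify hk hJc hJC'
  have hpRi : ∀ τ, Integrable fun x => p (U τ x) * R τ x := fun τ =>
    integrable_comp_mollify_mul hp hkb (h.curve.integrable τ) (hRi τ)
  set Φ : ℝ → E → ℝ := fun τ x => w' τ * J (U τ x) + w τ * (p (U τ x) * R τ x) with hΦ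
  have hΦc : Continuous fun q : ℝ × E => Φ q.1 q.2 :=
    ((hw'.comp continuous_fst).mul (hJc.comp hUc)).add
      ((hwc.comp continuous_fst).mul ((hp.comp hUc).mul hRc))
  have hΦi : ∀ τ, Integrable (Φ τ) := fun τ =>
    ((hJi τ).const_mul _).add ((hpRi τ).const_mul _)
  have hprod : Integrable (fun q : ℝ × E => Φ q.1 q.2)
      ((volume.restrict (Ioc 0 t)).prod volume) := by
    refine (integrable_prod_iff hΦc.aestronglyMeasurable).2 ⟨Eventually.of_forall hΦi, ?_⟩
    have hbc : Continuous fun τ => |w' τ| * (C * ∫ x, |v τ x|) +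
        |w τ| * (C * (D * (∫ x, |v τ x|) + D * ∫ x, |F (v τ x)|)) := by
      have h1 := h.curve.continuous_integral_abs
      have h2 := h.flux_curve.continuous_integral_abs
      fun_prop
    have hbi : IntegrableOn (fun τ => |w' τ| * (C * ∫ x, |v τ x|) +
        |w τ| * (C * (D * (∫ x, |v τ x|) + D * ∫ x, |F (v τ x)|))) (Ioc 0 t) :=
      (hbc.integrableOn_Icc).mono_set Ioc_subset_Icc_self
    refine hbi.mono' (hΦc.norm.aestronglyMeasurable.integral_prod_right'
      (f := fun q : ℝ × E => ‖Φ q.1 q.2‖)) (Eventually.of_forall fun τ => ?_)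
    rw [Real.norm_of_nonneg (integral_nonneg fun x => norm_nonneg _)]
    have e1 : ∫ x, |U τ x| ≤ ∫ x, |v τ x| := by
      have := integral_abs_mollify_le hkb (h.curve.integrable τ)
      rwa [hk.integral_abs, mul_one] at this
    have e2 := hD (v τ) (fun x => F (v τ x)) (h.curve.integrable τ) (h.flux_curve.integrable τ)
    calc ∫ x, ‖Φ τ x‖ ≤ ∫ x, (|w' τ| * (C * |U τ x|) + |w τ| * (C * |R τ x|)) := by
          refine integral_mono (hΦi τ).norm ((((hUi τ).abs.const_mul _).const_mul _).add
            (((hRi τ).abs.const_mul _).const_mul _)) fun x => ?_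
          simp only [hΦ, Real.norm_eq_abs]
          refine (abs_add_le _ _).trans ?_
          rw [abs_mul, abs_mul, abs_mul]
          have := hJC' _ (hUM τ x)
          have := hpC _ (hUM τ x)
          gcongr
      _ = |w' τ| * (C * ∫ x, |U τ x|) + |w τ| * (C * ∫ x, |R τ x|) := by
          rw [integral_add (((hUi τ).abs.const_mul _).const_mul _)
            (((hRi τ).abs.const_mul _).const_mul _)]
          simp only [integral_const_mul]
      _ ≤ _ := by gcongr
  have hint : ∀ τ, ∫ x, Φ τ x = w' τ * (∫ x, J (U τ x)) + w τ * ∫ x, p (U τ x) * R τ x := by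
    intro τ
    simp only [hΦ]
    rw [integral_add ((hJi τ).const_mul _) ((hpRi τ).const_mul _), integral_const_mul,
      integral_const_mul]
  have hptw : ∀ x, ∫ τ in Ioc 0 t, Φ τ x = w t * J (U t x) - w 0 * J (U 0 x) := by
    intro x
    have hc : Continuous fun τ : ℝ => (τ, x) := by fun_prop
    have hUx : Continuous fun τ => U τ x := hUc.comp hc
    have hΦx : Continuous fun τ => Φ τ x := hΦc.comp hc
    rw [← intervalIntegral.integral_of_le ht]
    refine intervalIntegral.integral_eq_sub_of_hasDerivAt_of_le ht
      (f := fun τ => w τ * J (U τ x)) (hwc.mul (hJc.comp hUx)).continuousOn (fun τ hτ => ?_)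
      (hΦx.intervalIntegrable _ _)
    exact (hw τ).mul ((hJ (U τ x)).comp τ (h.hasDerivAt k hkb x τ hτ.1))
  have hswap := integral_integral_swap (f := Φ) hprod
  simp_rw [hint, hptw] at hswap
  refine ⟨?_, ?_⟩
  · have := hprod.integral_prod_left
    simp_rw [hint] at this
    exact this
  · rw [hswap, integral_sub ((hJi t).const_mul _) ((hJi 0).const_mul _), integral_const_mul,
      integral_const_mul]

/-- The `L¹` size of the commutator between mollification and the nonlinearity. -/
noncomputable def commutator (F : ℝ → ℝ) (K : ℝ) (k f : E → ℝ) : ℝ :=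
  (∫ x, |mollify k (fun x => F (f x)) x - F (f x)|) + K * ∫ x, |mollify k f x - f x|

theorem integral_abs_mollify_sub_self_le {k f : E → ℝ} (hk : IsMollifier k) (hf : Integrable f) :
    ∫ x, |mollify k f x - f x| ≤ 2 * ∫ x, |f x| := by
  have h1 := integral_abs_mollify_le hk.toIsBump hf
  rw [hk.integral_abs, mul_one] at h1
  have hi := integrable_mollify hk.toIsBump hf
  have : ∫ x, |mollify k f x - f x| ≤ ∫ x, (|mollify k f x| + |f x|) :=
    integral_mono (hi.sub hf).abs (hi.abs.add hf.abs) fun x => abs_sub _ _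
  rw [integral_add hi.abs hf.abs] at this
  linarith

theorem _root_.IsBoundedL1Curve.mollify_sub_self {v : ℝ → E → ℝ} {M : ℝ}
    (hv : IsBoundedL1Curve v M) {k : E → ℝ} (hk : IsMollifier k) :
    IsBoundedL1Curve (fun t x => mollify k (v t) x - v t x) (M + M) := by
  refine ⟨fun t => (continuous_mollify hk.toIsBump (hv.integrable t)).measurable.sub
    (hv.measurable t), fun t => (integrable_mollify hk.toIsBump (hv.integrable t)).sub
    (hv.integrable t), fun t x => (abs_sub _ _).trans
      (add_le_add (hk.abs_mollify_le (hv.abs_le t) x) (hv.abs_le t x)), fun t => ?_⟩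
  have h := (hv.tendsto t).const_mul 2
  rw [mul_zero] at h
  refine squeeze_zero (fun s => integral_nonneg fun x => abs_nonneg _) (fun s => ?_) h
  refine le_trans (le_of_eq ?_)
    (integral_abs_mollify_sub_self_le hk ((hv.integrable s).sub (hv.integrable t)))
  congr 1
  ext x
  have := mollify_sub hk.toIsBump (hv.integrable s) (hv.integrable t) x
  simp only [this]
  congr 1
  ring

theorem continuous_commutator (h : IsMollifiedSolution a F v M K) {k : E → ℝ}
    (hk : IsMollifier k) : Continuous fun t => commutator F K k (v t) :=
  (h.flux_curve.mollify_sub_self hk).continuous_integral_abs.add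
    (continuous_const.mul (h.curve.mollify_sub_self hk).continuous_integral_abs)

theorem commutator_le (h : IsMollifiedSolution a F v M K) {k : E → ℝ}
    (hk : IsMollifier k) (t : ℝ) :
    commutator F K k (v t) ≤ 2 * (∫ x, |F (v t x)|) + K * (2 * ∫ x, |v t x|) :=
  add_le_add (integral_abs_mollify_sub_self_le hk (h.flux_curve.integrable t))
    (mul_le_mul_of_nonneg_left (integral_abs_mollify_sub_self_le hk (h.curve.integrable t))
      h.lipschitz_nonneg)

theorem commutator_nonneg (h : IsMollifiedSolution a F v M K) (k : E → ℝ) (t : ℝ) :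
    0 ≤ commutator F K k (v t) :=
  add_nonneg (integral_nonneg fun _ => abs_nonneg _)
    (mul_nonneg h.lipschitz_nonneg (integral_nonneg fun _ => abs_nonneg _))

/-- The commutator is bounded by `2KM`, so its squared `L²` norm is at most this bound times its
`L¹` norm, and `L¹` convergence of mollifications is enough. -/
theorem integral_sq_commutator_le (h : IsMollifiedSolution a F v M K) {k : E → ℝ}
    (hk : IsMollifier k) (t : ℝ) :
    Integrable (fun x => (mollify k (fun x => F (v t x)) x - F (mollify k (v t) x)) ^ 2) ∧
    ∫ x, (mollify k (fun x => F (v t x)) x - F (mollify k (v t) x)) ^ 2 ≤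
      2 * (K * M) * commutator F K k (v t) := by
  have hkb := hk.toIsBump
  have hfl := h.flux_curve
  have hM0 := h.curve.nonneg
  have hUM := hk.abs_mollify_le (h.curve.abs_le t)
  have hFU : ∀ x, |x| ≤ M → |F x| ≤ K * |x| := fun x hx => by
    simpa [h.flux_zero] using h.lipschitz x 0 hx (by simpa using hM0)
  have i1 := integrable_mollify hkb (hfl.integrable t)
  have i2 := h.integrable_comp_mollify hk h.continuous_flux hFU t
  have i3 := integrable_mollify hkb (h.curve.integrable t)
  have hb : ∀ x, |mollify k (fun x => F (v t x)) x - F (mollify k (v t) x)| ≤ 2 * (K * M) := by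
    intro x
    refine (abs_sub _ _).trans ?_
    have e1 := hk.abs_mollify_le (hfl.abs_le t) x
    have e2 := (hFU _ (hUM x)).trans (mul_le_mul_of_nonneg_left (hUM x) h.lipschitz_nonneg)
    linarith
  have hsq := integrable_sq (i1.sub i2) hb
  refine ⟨hsq, ?_⟩
  have hL1 : ∫ x, |mollify k (fun x => F (v t x)) x - F (mollify k (v t) x)| ≤
      commutator F K k (v t) := by
    have j1 : Integrable fun x => |mollify k (fun x => F (v t x)) x - F (v t x)| :=
      (i1.sub (hfl.integrable t)).abs
    have j2 : Integrable fun x => K * |mollify k (v t) x - v t x| :=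
      (i3.sub (h.curve.integrable t)).abs.const_mul _
    rw [commutator, ← integral_const_mul, ← integral_add j1 j2]
    refine integral_mono (i1.sub i2).abs (j1.add j2) fun x => ?_
    refine (abs_sub_le _ (F (v t x)) _).trans (add_le_add le_rfl ?_)
    rw [abs_sub_comm]
    exact h.lipschitz _ _ (hUM x) (h.curve.abs_le t x)
  calc _ ≤ ∫ x, 2 * (K * M) * |mollify k (fun x => F (v t x)) x - F (mollify k (v t) x)| := by
        refine integral_mono hsq ((i1.sub i2).abs.const_mul _) fun x => ?_
        simp only
        rw [← sq_abs, sq]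
        exact mul_le_mul_of_nonneg_right (hb x) (abs_nonneg _)
    _ ≤ _ := by
        rw [integral_const_mul]
        exact mul_le_mul_of_nonneg_left hL1
          (mul_nonneg two_pos.le (mul_nonneg h.lipschitz_nonneg hM0))

/-- Weighted energy inequality at the mollified level. -/
theorem mollified_energy_le (h : IsMollifiedSolution a F v M K) {k : E → ℝ} (hk : IsMollifier k)
    {J p q : ℝ → ℝ} (hJ : ∀ s, HasDerivAt J (p s) s) (hp : ∀ s, HasDerivAt p (q s) s)
    (hq : Continuous q) (hq0 : ∀ s, 0 ≤ q s) (hJ0 : J 0 = 0) {L : ℝ} (hL0 : 0 ≤ L)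
    (hL : ∀ s, |s| ≤ M → q s ≤ L) {w w' : ℝ → ℝ} (hw : ∀ s, HasDerivAt w (w' s) s)
    (hw' : Continuous w') {t W : ℝ} (ht : 0 ≤ t) (hw0 : ∀ s ∈ Ioc 0 t, 0 ≤ w s)
    (hW : ∀ s ∈ Ioc 0 t, w s ≤ W) {b : ℝ → ℝ} (hbi : IntegrableOn b (Ioc 0 t))
    (hb : ∀ s ∈ Ioc 0 t, w' s * (∫ x, J (mollify k (v s) x)) - w s / 2 *
      (∫ x, q (mollify k (v s) x) * ‖fderiv ℝ (mollify k (v s)) x‖ ^ 2) ≤ b s) :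
    w t * (∫ x, J (mollify k (v t) x)) - w 0 * (∫ x, J (mollify k (v 0) x)) ≤
      (∫ s in Ioc 0 t, b s) +
        W * (L * ‖a‖ ^ 2 / 2) * (2 * (K * M)) * ∫ s in Ioc 0 t, commutator F K k (v s) := by
  have hpc : Continuous p := continuous_iff_continuousAt.2 fun s => (hp s).continuousAt
  obtain ⟨hi, he⟩ := h.energy_identity hk hJ hpc hJ0 hw hw' ht
  have hci : IntegrableOn (fun s => commutator F K k (v s)) (Ioc 0 t) :=
    (h.continuous_commutator hk).integrableOn_Icc.mono_set Ioc_subset_Icc_self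
  rw [he, ← integral_const_mul, ← integral_add hbi (hci.const_mul _)]
  refine setIntegral_mono_on hi (hbi.add (hci.const_mul _)) measurableSet_Ioc fun s hs => ?_
  obtain ⟨hEi, hE⟩ := h.integral_sq_commutator_le hk s
  have h1 := integral_comp_mollify_mul_rhs_le hp hq hq0 h.continuous_flux hk
    (h.curve.integrable s) (h.flux_curve.integrable s) (h.curve.abs_le s) hL a hEi
  have h2 := mul_le_mul_of_nonneg_left h1 (hw0 s hs)
  have hc0 : 0 ≤ L * ‖a‖ ^ 2 / 2 := by positivity
  have hS0 : 0 ≤ ∫ x, (mollify k (fun x => F (v s x)) x - F (mollify k (v s) x)) ^ 2 :=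
    integral_nonneg fun x => sq_nonneg _
  have h3 : w s * (L * ‖a‖ ^ 2 / 2 *
      ∫ x, (mollify k (fun x => F (v s x)) x - F (mollify k (v s) x)) ^ 2) ≤
      W * (L * ‖a‖ ^ 2 / 2 * (2 * (K * M) * commutator F K k (v s))) :=
    mul_le_mul (hW s hs) (mul_le_mul_of_nonneg_left hE hc0) (mul_nonneg hc0 hS0)
      ((hw0 s hs).trans (hW s hs))
  have h4 := hb s hs
  linarith

theorem tendsto_commutator (h : IsMollifiedSolution a F v M K) {k : ℕ → E → ℝ}
    (hk : ∀ f : E → ℝ, Integrable f →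
      Tendsto (fun n => ∫ x, |mollify (k n) f x - f x|) atTop (𝓝 0)) (t : ℝ) :
    Tendsto (fun n => commutator F K (k n) (v t)) atTop (𝓝 0) := by
  have := (hk _ (h.flux_curve.integrable t)).add ((hk _ (h.curve.integrable t)).const_mul K)
  simpa [commutator] using this

theorem integrable_comp (h : IsMollifiedSolution a F v M K) {J : ℝ → ℝ} (hJ : Continuous J)
    {C : ℝ} (hC : ∀ x, |x| ≤ M → |J x| ≤ C * |x|) (t : ℝ) : Integrable fun x => J (v t x) :=
  ((h.curve.integrable t).abs.const_mul C).mono'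
    (hJ.measurable.comp (h.curve.measurable t)).aestronglyMeasurable
    (Eventually.of_forall fun x => hC _ (h.curve.abs_le t x))

/-- Weighted energy inequality, after removing the mollification. -/
theorem energy_le (h : IsMollifiedSolution a F v M K)
    {J p q : ℝ → ℝ} (hJ : ∀ s, HasDerivAt J (p s) s) (hp : ∀ s, HasDerivAt p (q s) s)
    (hq : Continuous q) (hq0 : ∀ s, 0 ≤ q s) (hJ0 : J 0 = 0) {w w' : ℝ → ℝ}
    (hw : ∀ s, HasDerivAt w (w' s) s)
    (hw' : Continuous w') {t : ℝ} (ht : 0 ≤ t) (hw0 : ∀ s ∈ Ioc 0 t, 0 ≤ w s)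
    {b : ℝ → ℝ} (hbi : IntegrableOn b (Ioc 0 t))
    -- The bound `b` is the same for all kernels, so it survives the limit.
    (hb : ∀ k : E → ℝ, IsMollifier k → ∀ s ∈ Ioc 0 t,
      w' s * (∫ x, J (mollify k (v s) x)) - w s / 2 *
      (∫ x, q (mollify k (v s) x) * ‖fderiv ℝ (mollify k (v s)) x‖ ^ 2) ≤ b s) :
    w t * (∫ x, J (v t x)) - w 0 * (∫ x, J (v 0 x)) ≤ ∫ s in Ioc 0 t, b s := by
  obtain ⟨k, hk, hlim⟩ := exists_mollifier_seq E
  have hpc : Continuous p := continuous_iff_continuousAt.2 fun s => (hp s).continuousAt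
  have hJc : Continuous J := continuous_iff_continuousAt.2 fun s => (hJ s).continuousAt
  have hwc : Continuous w := continuous_iff_continuousAt.2 fun s => (hw s).continuousAt
  have hM0 := h.curve.nonneg
  obtain ⟨C, hC0, -, hJC⟩ := exists_lipschitz_bound hJ hpc M
  have hJC' : ∀ x, |x| ≤ M → |J x| ≤ C * |x| := fun x hx => by
    simpa [hJ0] using hJC x 0 hx (by simpa using hM0)
  obtain ⟨L, hL⟩ := (isCompact_Icc (a := -M) (b := M)).exists_bound_of_continuousOn hq.continuousOn
  obtain ⟨W, hW⟩ := (isCompact_Icc (a := 0) (b := t)).exists_bound_of_continuousOn hwc.continuousOn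
  have hL0 : 0 ≤ L := (norm_nonneg _).trans (hL 0 ⟨by linarith, hM0⟩)
  have hJlim : ∀ s, Tendsto (fun n => ∫ x, J (mollify (k n) (v s) x)) atTop
      (𝓝 (∫ x, J (v s x))) := by
    intro s
    have h1 := (hlim _ (h.curve.integrable s)).const_mul C
    rw [mul_zero] at h1
    refine tendsto_iff_dist_tendsto_zero.2 (squeeze_zero (fun _ => dist_nonneg) (fun n => ?_) h1)
    have i1 := h.integrable_comp_mollify (hk n) hJc hJC' s
    have i2 := h.integrable_comp hJc hJC' s
    have i3 := integrable_mollify (hk n).toIsBump (h.curve.integrable s)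
    rw [Real.dist_eq, ← integral_sub i1 i2, ← integral_const_mul]
    exact abs_integral_le_integral_abs.trans (integral_mono (i1.sub i2).abs
      ((i3.sub (h.curve.integrable s)).abs.const_mul C) fun x =>
        hJC _ _ ((hk n).abs_mollify_le (h.curve.abs_le s) x) (h.curve.abs_le s x))
  -- Dominated convergence in time, with the majorant of `commutator_le`, which does not depend on
  -- the kernel.
  have hcomm : Tendsto (fun n => ∫ s in Ioc 0 t, commutator F K (k n) (v s)) atTop (𝓝 0) := by
    have hbound : Continuous fun s => 2 * (∫ x, |F (v s x)|) + K * (2 * ∫ x, |v s x|) := by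
      have h1 := h.curve.continuous_integral_abs
      have h2 := h.flux_curve.continuous_integral_abs
      fun_prop
    have := tendsto_integral_of_dominated_convergence
      (μ := volume.restrict (Ioc 0 t)) (F := fun n s => commutator F K (k n) (v s))
      (f := fun _ => (0 : ℝ)) _
      (fun n => (h.continuous_commutator (hk n)).aestronglyMeasurable)
      (hbound.integrableOn_Icc.mono_set Ioc_subset_Icc_self)
      (fun n => Eventually.of_forall fun s => by
        rw [Real.norm_of_nonneg (h.commutator_nonneg _ _)]
        exact h.commutator_le (hk n) s)
      (Eventually.of_forall fun s => h.tendsto_commutator hlim s)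
    simpa using this
  -- The quantities `a`, `K`, `L`, `M`, `W` enter the error only as a factor of the vanishing
  -- commutator; this makes the final constant universal.
  have hr := (hcomm.const_mul (W * (L * ‖a‖ ^ 2 / 2) * (2 * (K * M)))).const_add
    (∫ s in Ioc 0 t, b s)
  rw [mul_zero, add_zero] at hr
  refine le_of_tendsto_of_tendsto' (((hJlim t).const_mul (w t)).sub ((hJlim 0).const_mul (w 0)))
    hr fun n => ?_
  exact h.mollified_energy_le (hk n) hJ hp hq hq0 hJ0 hL0
    (fun s hs => (le_abs_self _).trans (hL s (abs_le.1 hs))) hw hw' ht hw0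
    (fun s hs => (le_abs_self _).trans (hW s (Ioc_subset_Icc_self hs))) hbi (hb _ (hk n))

end IsMollifiedSolution

end Energy

/-! ### Monotonicity of the `L¹` norm and the moment-doubling step. -/

section Decay

variable {E : Type*} [NormedAddCommGroup E] [InnerProductSpace ℝ E] [FiniteDimensional ℝ E]
  [MeasurableSpace E] [BorelSpace E]

namespace IsMollifiedSolution

variable {a : E} {F : ℝ → ℝ} {v : ℝ → E → ℝ} {M K : ℝ}

/-- `√(s² + η²) - η` is a smooth convex substitute for `|s|` that vanishes at `0`. With constant
weight the dissipation can simply be discarded. -/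
theorem integral_sqrt_le (h : IsMollifiedSolution a F v M K) {η : ℝ} (hη : 0 < η) {t : ℝ}
    (ht : 0 ≤ t) :
    ∫ x, (√(v t x ^ 2 + η ^ 2) - η) ≤ ∫ x, (√(v 0 x ^ 2 + η ^ 2) - η) := by
  have hpos : ∀ s : ℝ, 0 < s ^ 2 + η ^ 2 := fun s => by positivity
  have hS : ∀ s : ℝ, HasDerivAt (fun s => √(s ^ 2 + η ^ 2)) (s / √(s ^ 2 + η ^ 2)) s := by
    intro s
    have h1 : HasDerivAt (fun s : ℝ => s ^ 2 + η ^ 2) (2 * s) s := by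
      simpa using (hasDerivAt_pow 2 s).add_const (η ^ 2)
    convert! h1.sqrt (hpos s).ne' using 1
    ring
  have hSpos : ∀ s : ℝ, 0 < √(s ^ 2 + η ^ 2) := fun s => Real.sqrt_pos.2 (hpos s)
  have hp : ∀ s : ℝ, HasDerivAt (fun s => s / √(s ^ 2 + η ^ 2))
      (η ^ 2 / √(s ^ 2 + η ^ 2) ^ 3) s := by
    intro s
    convert! (hasDerivAt_id s).div (hS s) (hSpos s).ne' using 1
    have h2 : √(s ^ 2 + η ^ 2) ^ 2 = s ^ 2 + η ^ 2 := Real.sq_sqrt (hpos s).le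
    have h3 := (hSpos s).ne'
    have h4 : η ^ 2 = √(s ^ 2 + η ^ 2) ^ 2 - s ^ 2 := by rw [h2]; ring
    simp only [id]
    set S := √(s ^ 2 + η ^ 2)
    rw [h4]
    field_simp
  have hq : Continuous fun s : ℝ => η ^ 2 / √(s ^ 2 + η ^ 2) ^ 3 :=
    continuous_const.div (by fun_prop) fun s => (pow_pos (hSpos s) 3).ne'
  have := h.energy_le (J := fun s => √(s ^ 2 + η ^ 2) - η) (w := fun _ => 1) (w' := fun _ => 0)
    (b := fun _ => 0) (fun s => (hS s).sub_const η) hp hq (fun s => by positivity)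
    (by simp [Real.sqrt_sq hη.le]) (fun s => hasDerivAt_const s 1) continuous_const ht
    (fun s _ => zero_le_one) integrableOn_zero (fun k _ s _ => ?_)
  · simpa using this
  · have : 0 ≤ ∫ x, η ^ 2 / √(mollify k (v s) x ^ 2 + η ^ 2) ^ 3 *
        ‖fderiv ℝ (mollify k (v s)) x‖ ^ 2 := integral_nonneg fun x => by positivity
    linarith

/-- The `L¹` norm does not increase. -/
theorem integral_abs_le (h : IsMollifiedSolution a F v M K) {t : ℝ} (ht : 0 ≤ t) :
    ∫ x, |v t x| ≤ ∫ x, |v 0 x| := by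
  let η : ℕ → ℝ := fun n => 1 / (n + 1 : ℝ)
  have hη : ∀ n, 0 < η n := fun n => by positivity
  have hη0 : Tendsto η atTop (𝓝 0) := tendsto_one_div_add_atTop_nhds_zero_nat
  have hle : ∀ n s, √(s ^ 2 + η n ^ 2) - η n ≤ |s| := fun n s => by
    rw [sub_le_iff_le_add]
    refine Real.sqrt_le_iff.2 ⟨add_nonneg (abs_nonneg _) (hη n).le, ?_⟩
    rw [add_sq, sq_abs]
    nlinarith [mul_nonneg (abs_nonneg s) (hη n).le]
  have hge : ∀ n s, 0 ≤ √(s ^ 2 + η n ^ 2) - η n := fun n s => by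
    rw [sub_nonneg]
    exact Real.le_sqrt_of_sq_le (by nlinarith [sq_nonneg s])
  have hJc : ∀ n, Continuous fun s => √(s ^ 2 + η n ^ 2) - η n := fun n => by fun_prop
  have hJi : ∀ n t, Integrable fun x => √(v t x ^ 2 + η n ^ 2) - η n := fun n =>
    h.integrable_comp (hJc n) (C := 1) fun s _ => by
      rw [abs_of_nonneg (hge n s), one_mul]
      exact hle n s
  have hlim : Tendsto (fun n => ∫ x, (√(v t x ^ 2 + η n ^ 2) - η n)) atTop
      (𝓝 (∫ x, |v t x|)) := by
    refine tendsto_integral_of_dominated_convergence _ (fun n => (hJi n t).aestronglyMeasurable)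
      (h.curve.integrable t).abs (fun n => Eventually.of_forall fun x => ?_)
      (Eventually.of_forall fun x => ?_)
    · rw [Real.norm_of_nonneg (hge n _)]
      exact hle n _
    · have h1 : Tendsto (fun n => √(v t x ^ 2 + η n ^ 2) - η n) atTop
          (𝓝 (√(v t x ^ 2 + 0 ^ 2) - 0)) :=
        (((hη0.pow 2).const_add _).sqrt).sub hη0
      simpa [Real.sqrt_sq_eq_abs] using h1
  exact le_of_tendsto' hlim fun n => (h.integral_sqrt_le (hη n) ht).trans
    (integral_mono (hJi n 0) (h.curve.integrable 0).abs fun x => hle n _)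

theorem fderiv_mollify_pow (k f : E → ℝ) (hk : IsBump k) (hf : Integrable f) (n : ℕ) (x : E) :
    ‖fderiv ℝ (fun x => mollify k f x ^ (n + 1)) x‖ ^ 2 =
      (n + 1) ^ 2 * mollify k f x ^ (2 * n) * ‖fderiv ℝ (mollify k f) x‖ ^ 2 := by
  have h1 := ((hasDerivAt_pow (n + 1) (mollify k f x)).comp_hasFDerivAt x
    (differentiable_mollify hk hf x).hasFDerivAt).fderiv
  have h2 : fderiv ℝ (fun x => mollify k f x ^ (n + 1)) x =
    (((n + 1 : ℕ) : ℝ) * mollify k f x ^ (n + 1 - 1)) • fderiv ℝ (mollify k f) x := h1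
  rw [h2, norm_smul, mul_pow, Real.norm_eq_abs, sq_abs]
  simp only [Nat.add_sub_cancel, Nat.cast_add, Nat.cast_one]
  ring

/-- Nash's inequality applied to a power of a mollification, against the dissipation. -/
theorem integral_mollify_pow_le (k f : E → ℝ) (hk : IsMollifier k) (hf : Integrable f)
    (hM : ∀ x, |f x| ≤ M) (n : ℕ) {r : ℝ} (hr : 0 < r) :
    ∫ x, mollify k f x ^ (2 * n + 2) ≤ r ^ 2 / 4 *
      (∫ x, ((2 * n + 2) * ((2 * n + 1) * mollify k f x ^ (2 * n))) *
        ‖fderiv ℝ (mollify k f) x‖ ^ 2) +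
      (∫ x, |f x| ^ (n + 1)) ^ 2 /
        (r ^ Module.finrank ℝ E * volume.real (Metric.ball (0 : E) 1)) := by
  have hkb := hk.toIsBump
  set U := mollify k f with hU
  have hUi : Integrable U := integrable_mollify hkb hf
  have hUM : ∀ x, |U x| ≤ M := hk.abs_mollify_le hM
  have hUc : Continuous U := continuous_mollify hkb hf
  have hDi := integrable_norm_fderiv_mollify_sq hkb hf
  have hV : ContDiff ℝ 1 fun x => U x ^ (n + 1) :=
    ((contDiff_mollify hkb hf).of_le (by simp)).pow (n + 1)
  have hVi : Integrable fun x => U x ^ (n + 1) := by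
    refine (integrable_abs_pow hUi hUM (m := n + 1) (by omega)).mono'
      (hUc.pow _).aestronglyMeasurable (Eventually.of_forall fun x => ?_)
    rw [norm_pow, Real.norm_eq_abs]
  have hVb : ∀ x, |U x ^ (n + 1)| ≤ M ^ (n + 1) := fun x => by
    rw [abs_pow]
    exact pow_le_pow_left₀ (abs_nonneg _) (hUM x) _
  have hGi : Integrable fun x => ‖fderiv ℝ (fun x => U x ^ (n + 1)) x‖ ^ 2 := by
    simp_rw [hU, fderiv_mollify_pow k f hkb hf n]
    exact integrable_comp_mollify_mul (p := fun s => ((n : ℝ) + 1) ^ 2 * s ^ (2 * n))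
      (by fun_prop) hkb hf hDi
  have hQi : Integrable fun x => ((2 * n + 2) * ((2 * n + 1) * U x ^ (2 * n))) *
      ‖fderiv ℝ U x‖ ^ 2 :=
    integrable_comp_mollify_mul (p := fun s => (2 * (n : ℝ) + 2) * ((2 * n + 1) * s ^ (2 * n)))
      (by fun_prop) hkb hf hDi
  have hnash := integral_sq_le_of_scale hV hVi hVb hGi hr
  -- The coefficients compare as `2 (n + 1)² ≤ (2n + 2)(2n + 1)`.
  have hGQ : 2 * ∫ x, ‖fderiv ℝ (fun x => U x ^ (n + 1)) x‖ ^ 2 ≤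
      ∫ x, ((2 * n + 2) * ((2 * n + 1) * U x ^ (2 * n))) * ‖fderiv ℝ U x‖ ^ 2 := by
    rw [← integral_const_mul]
    refine integral_mono (hGi.const_mul 2) hQi fun x => ?_
    simp only
    rw [hU, fderiv_mollify_pow k f hkb hf n, ← hU]
    have h0 : 0 ≤ U x ^ (2 * n) * ‖fderiv ℝ U x‖ ^ 2 := by
      rw [mul_comm 2 n, pow_mul]
      positivity
    have hn : (0 : ℝ) ≤ n := n.cast_nonneg
    have : 0 ≤ (2 * n * (n + 1) : ℝ) * (U x ^ (2 * n) * ‖fderiv ℝ U x‖ ^ 2) := by positivity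
    linarith
  have hball : volume.real (Metric.ball (0 : E) r) =
      r ^ Module.finrank ℝ E * volume.real (Metric.ball (0 : E) 1) := by
    rw [measureReal_def, Measure.addHaar_ball_of_pos _ _ hr, ENNReal.toReal_mul,
      ENNReal.toReal_ofReal (by positivity), measureReal_def]
  have hS : (∫ x, |U x ^ (n + 1)|) ^ 2 ≤ (∫ x, |f x| ^ (n + 1)) ^ 2 := by
    simp_rw [abs_pow]
    exact pow_le_pow_left₀ (integral_nonneg fun x => by positivity)
      (hk.integral_abs_mollify_pow_le hf hM (by omega)) 2
  rw [hball] at hnash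
  have hpow : ∀ x, (U x ^ (n + 1)) ^ 2 = U x ^ (2 * n + 2) := fun x => by
    rw [← pow_mul]
    congr 1
    ring
  simp_rw [hpow] at hnash
  refine hnash.trans (add_le_add ?_ ?_)
  · have := mul_le_mul_of_nonneg_left hGQ (show 0 ≤ r ^ 2 / 4 by positivity)
    linarith
  · exact div_le_div_of_nonneg_right hS (by positivity)

theorem integral_rpow_half {d t : ℝ} (hd : 0 < d) (ht : 0 ≤ t) :
    IntegrableOn (fun s : ℝ => s ^ (d / 2 - 1)) (Ioc 0 t) ∧
      ∫ s in Ioc 0 t, s ^ (d / 2 - 1) = t ^ (d / 2) / (d / 2) := by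
  have h1 : -1 < d / 2 - 1 := by linarith
  refine ⟨(intervalIntegrable_iff_integrableOn_Ioc_of_le ht).1
    (intervalIntegral.intervalIntegrable_rpow' h1), ?_⟩
  rw [← intervalIntegral.integral_of_le ht, integral_rpow (Or.inl h1), sub_add_cancel,
    Real.zero_rpow (by positivity), sub_zero]

/-- Decay of the moment of order `n + 1` improves to decay of the moment of order `2 (n + 1)`. -/
theorem integral_pow_step (h : IsMollifiedSolution a F v M K) (hd : 1 ≤ Module.finrank ℝ E)
    (n : ℕ) {A : ℝ}
    (hA : ∀ s, 0 < s → ∫ x, |v s x| ^ (n + 1) ≤ A * s ^ (-((Module.finrank ℝ E : ℝ) / 2) * n))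
    {t : ℝ} (ht : 0 < t) :
    ∫ x, |v t x| ^ (2 * n + 2) ≤ 2 * (Module.finrank ℝ E : ℝ) ^ Module.finrank ℝ E /
      volume.real (Metric.ball (0 : E) 1) * (n + 1 : ℝ) ^ (Module.finrank ℝ E + 1) * A ^ 2 *
      t ^ (-((Module.finrank ℝ E : ℝ) / 2) * (2 * n + 1)) := by
  set d := Module.finrank ℝ E
  set c := volume.real (Metric.ball (0 : E) 1)
  have hc : 0 < c := ENNReal.toReal_pos (Metric.measure_ball_pos _ _ one_pos).ne'
    measure_ball_lt_top.ne
  have hdR : (0 : ℝ) < d := by exact_mod_cast hd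
  -- The weight is `s ^ κ` with `κ = d (n + 1)`: it vanishes at time `0`, which removes the initial
  -- moment, and it leaves the integrable power `s ^ (d/2 - 1)` on the right. Writing `κ = κ' + 1`
  -- keeps the exponent of its derivative a natural number.
  obtain ⟨κ', hκ'⟩ : ∃ κ', d * (n + 1) = κ' + 1 :=
    Nat.exists_eq_add_of_le' (Nat.mul_pos hd (Nat.succ_pos n))
  set κ : ℝ := κ' + 1 with hκdef
  have hκ : κ = d * (n + 1) := by rw [hκdef]; exact_mod_cast hκ'.symm
  have hκ1 : 1 ≤ κ := by rw [hκdef]; linarith [κ'.cast_nonneg (α := ℝ)]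
  have hκ0 : 0 < κ := by linarith
  obtain ⟨hri, hre⟩ := integral_rpow_half hdR ht.le
  have heven : ∀ (s : ℝ) (j : ℕ), 0 ≤ s ^ (2 * j) := fun s j => by
    rw [mul_comm, pow_mul]; positivity
  have key := h.energy_le (J := fun s => s ^ (2 * n + 2))
    (p := fun s => (2 * n + 2) * s ^ (2 * n + 1))
    (q := fun s => (2 * n + 2) * ((2 * n + 1) * s ^ (2 * n)))
    (w := fun s => s ^ (κ' + 1)) (w' := fun s => κ * s ^ κ')
    (b := fun s => κ ^ (d + 1) / c * A ^ 2 * s ^ ((d : ℝ) / 2 - 1))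
    (fun s => by simpa using hasDerivAt_pow (2 * n + 2) s)
    (fun s => by simpa using (hasDerivAt_pow (2 * n + 1) s).const_mul (2 * (n : ℝ) + 2))
    (by fun_prop)
    (fun s => by have := heven s n; positivity)
    (by simp) (fun s => by simpa [hκdef] using hasDerivAt_pow (κ' + 1) s) (by fun_prop)
    ht.le (fun s hs => pow_nonneg hs.1.le _) (hri.const_mul _) ?_
  · rw [integral_const_mul, hre] at key
    have hab : ∀ x, |v t x| ^ (2 * n + 2) = v t x ^ (2 * n + 2) := fun x => by
      rw [show 2 * n + 2 = 2 * (n + 1) by ring, pow_mul, sq_abs, ← pow_mul]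
    simp_rw [hab]
    rw [zero_pow (Nat.succ_ne_zero _), zero_mul, sub_zero] at key
    have hκt : (0 : ℝ) < t ^ (κ' + 1) := by positivity
    have hexp : t ^ (-((d : ℝ) / 2) * (2 * n + 1)) * t ^ (κ' + 1) = t ^ ((d : ℝ) / 2) := by
      rw [← Real.rpow_natCast, ← Real.rpow_add ht]
      congr 1
      push_cast
      rw [← hκdef, hκ]
      ring
    rw [← mul_le_mul_iff_left₀ hκt, mul_assoc _ _ (t ^ (κ' + 1)), hexp,
      mul_comm _ (t ^ (κ' + 1))]
    refine key.trans (le_of_eq ?_)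
    rw [hκ, mul_pow, pow_succ (d : ℝ)]
    field_simp
  · intro k hk s hs
    have hs0 : 0 < s := hs.1
    -- At the scale `r = √s / κ` the gradient term of Nash's inequality, times `κ s ^ κ'`, is `s ^ κ
    -- Q / (4κ)`. Since `κ ≥ 1`, the available half of the dissipation absorbs it; the price is a
    -- factor `κ ^ d` in the other term.
    have hr : 0 < √s / κ := div_pos (Real.sqrt_pos.2 hs0) hκ0
    have hN := integral_mollify_pow_le k (v s) hk (h.curve.integrable s) (h.curve.abs_le s) n hr
    set Y := ∫ x, mollify k (v s) x ^ (2 * n + 2)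
    set Q := ∫ x, ((2 * n + 2) * ((2 * n + 1) * mollify k (v s) x ^ (2 * n))) *
        ‖fderiv ℝ (mollify k (v s)) x‖ ^ 2
    have hQ0 : 0 ≤ Q := integral_nonneg fun x => by
      have := heven (mollify k (v s) x) n
      positivity
    have hS := pow_le_pow_left₀ (integral_nonneg fun x => by positivity) (hA s hs0) 2
    have hsd : √s ^ d = s ^ ((d : ℝ) / 2) := by
      rw [Real.sqrt_eq_rpow, ← Real.rpow_natCast, ← Real.rpow_mul hs0.le]
      congr 1
      ring
    have hden : 0 < (√s / κ) ^ d * c := by positivity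
    have hN2 : Y ≤ s / κ ^ 2 / 4 * Q +
        (A * s ^ (-((d : ℝ) / 2) * n)) ^ 2 / ((√s / κ) ^ d * c) := by
      refine hN.trans (add_le_add (le_of_eq ?_) (div_le_div_of_nonneg_right hS hden.le))
      rw [div_pow, Real.sq_sqrt hs0.le]
    have hw' : 0 ≤ κ * s ^ κ' := by positivity
    have h1 := mul_le_mul_of_nonneg_left hN2 hw'
    have h2 : κ * s ^ κ' * (s / κ ^ 2 / 4 * Q) ≤ s ^ (κ' + 1) / 2 * Q := by
      have : κ * s ^ κ' * (s / κ ^ 2 / 4 * Q) = s ^ (κ' + 1) * Q / 4 / κ := by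
        rw [pow_succ]
        field_simp
        ring
      rw [this, div_le_iff₀ hκ0]
      have h0 : 0 ≤ s ^ (κ' + 1) * Q := by positivity
      nlinarith
    have h3 : κ * s ^ κ' * ((A * s ^ (-((d : ℝ) / 2) * n)) ^ 2 / ((√s / κ) ^ d * c)) =
        κ ^ (d + 1) / c * A ^ 2 * s ^ ((d : ℝ) / 2 - 1) := by
      have e : s ^ κ' * (s ^ (-((d : ℝ) / 2) * n)) ^ 2 = s ^ ((d : ℝ) / 2 - 1) * √s ^ d := by
        rw [hsd, ← Real.rpow_add hs0, ← Real.rpow_natCast, ← Real.rpow_natCast,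
          ← Real.rpow_mul hs0.le, ← Real.rpow_add hs0]
        congr 1
        have : (κ' : ℝ) = d * (n + 1) - 1 := by linarith
        rw [this]
        push_cast
        ring
      have hsd0 : √s ^ d ≠ 0 := by positivity
      rw [mul_pow, div_pow]
      calc κ * s ^ κ' * (A ^ 2 * (s ^ (-((d : ℝ) / 2) * n)) ^ 2 / (√s ^ d / κ ^ d * c))
          = κ ^ (d + 1) / c * A ^ 2 *
            ((s ^ κ' * (s ^ (-((d : ℝ) / 2) * n)) ^ 2) / √s ^ d) := by
            generalize s ^ (-((d : ℝ) / 2) * n) = X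
            rw [pow_succ κ]
            field_simp
        _ = _ := by rw [e, mul_div_cancel_right₀ _ hsd0]
    linarith

end IsMollifiedSolution

end Decay

/-! ### Iteration of the moments and the supremum bound. -/

section Supremum

variable {E : Type*} [NormedAddCommGroup E] [InnerProductSpace ℝ E] [FiniteDimensional ℝ E]
  [MeasurableSpace E] [BorelSpace E]

/-- The constant of the `L¹`–`L^∞` decay estimate. -/
noncomputable def decayConst (E : Type*) [NormedAddCommGroup E] [InnerProductSpace ℝ E]
    [FiniteDimensional ℝ E] [MeasurableSpace E] [BorelSpace E] : ℝ :=
  2 * (Module.finrank ℝ E : ℝ) ^ Module.finrank ℝ E / volume.real (Metric.ball (0 : E) 1) *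
    2 ^ (Module.finrank ℝ E + 1)

theorem decayConst_pos (hd : 1 ≤ Module.finrank ℝ E) : 0 < decayConst E := by
  have hc : 0 < volume.real (Metric.ball (0 : E) 1) :=
    ENNReal.toReal_pos (Metric.measure_ball_pos _ _ one_pos).ne' measure_ball_lt_top.ne
  have hdR : (0 : ℝ) < Module.finrank ℝ E := by exact_mod_cast hd
  unfold decayConst
  positivity

namespace IsMollifiedSolution

variable {a : E} {F : ℝ → ℝ} {v : ℝ → E → ℝ} {M K : ℝ}

/-- Iterate `n ↦ 2n + 1` from `n = 0`. The denominator `(n + 1) ^ (d + 1)` is built so that, once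
squared, it cancels the growth in `integral_pow_step` and still leaves one such power. Passing from
`n + 1` to `2n + 2` in it costs `2 ^ (d + 1)`, the last factor of `decayConst`. -/
theorem integral_pow_two_pow_le (h : IsMollifiedSolution a F v M K)
    (hd : 1 ≤ Module.finrank ℝ E) (j : ℕ) : ∃ n : ℕ, j ≤ n ∧ ∀ s, 0 < s →
      ∫ x, |v s x| ^ (n + 1) ≤ (∫ x, |v 0 x|) ^ (n + 1) * decayConst E ^ n /
        (n + 1 : ℝ) ^ (Module.finrank ℝ E + 1) * s ^ (-((Module.finrank ℝ E : ℝ) / 2) * n) := by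
  induction j with
  | zero =>
    refine ⟨0, le_rfl, fun s hs => ?_⟩
    simpa using h.integral_abs_le hs.le
  | succ j ih =>
    obtain ⟨n, hn, ih⟩ := ih
    refine ⟨2 * n + 1, by omega, fun s hs => ?_⟩
    refine (h.integral_pow_step hd n ih hs).trans (le_of_eq ?_)
    have hn1 : ((n : ℝ) + 1) ≠ 0 := by positivity
    have h2 : (((2 * n + 1 : ℕ) : ℝ) + 1) = 2 * (n + 1) := by push_cast; ring
    have h3 : ((2 * n + 1 : ℕ) : ℝ) = 2 * n + 1 := by push_cast; ring
    rw [h2, h3]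
    congr 1
    rw [mul_pow, pow_succ (decayConst E)]
    nth_rewrite 3 [decayConst]
    field_simp
    ring

theorem ae_abs_le (h : IsMollifiedSolution a F v M K) (hd : 1 ≤ Module.finrank ℝ E)
    {t : ℝ} (ht : 0 < t) : ∀ᵐ x, |v t x| ≤ (∫ x, |v 0 x|) *
      (decayConst E * t ^ (-((Module.finrank ℝ E : ℝ) / 2))) := by
  set m := ∫ x, |v 0 x| with hm
  set γ := decayConst E * t ^ (-((Module.finrank ℝ E : ℝ) / 2)) with hγ
  have hm0 : 0 ≤ m := integral_nonneg fun x => abs_nonneg _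
  have hB := decayConst_pos hd
  have hγ0 : 0 < γ := mul_pos hB (Real.rpow_pos_of_pos ht _)
  have hmom : ∀ j : ℕ, ∃ n : ℕ, j ≤ n ∧ ∫ x, |v t x| ^ (n + 1) ≤ (m * γ) ^ (n + 1) / γ := by
    intro j
    obtain ⟨n, hn, hb⟩ := h.integral_pow_two_pow_le hd j
    refine ⟨n, hn, (hb t ht).trans ?_⟩
    have e : (m * γ) ^ (n + 1) / γ = m ^ (n + 1) * decayConst E ^ n *
        t ^ (-((Module.finrank ℝ E : ℝ) / 2) * n) := by
      rw [mul_pow, pow_succ γ, mul_div_assoc, mul_div_cancel_right₀ _ hγ0.ne', hγ, mul_pow,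
        ← Real.rpow_natCast (t ^ _), ← Real.rpow_mul ht.le, mul_assoc]
    rw [e]
    -- The polynomial denominator is at least one and is no longer needed.
    refine mul_le_mul_of_nonneg_right (div_le_self (by positivity) ?_) (by positivity)
    exact one_le_pow₀ (by linarith [n.cast_nonneg (α := ℝ)])
  have hlevel : ∀ l, m * γ < l → ∀ᵐ x, |v t x| < l := by
    intro l hl
    have hb0 : 0 ≤ m * γ := mul_nonneg hm0 hγ0.le
    have hl0 : 0 < l := hb0.trans_lt hl
    set μ := volume.real {x | l ≤ |v t x|} with hμ
    have hfin : volume {x | l ≤ |v t x|} ≠ ⊤ :=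
      ((h.curve.integrable t).measure_norm_ge_lt_top hl0).ne
    -- Chebyshev's inequality at level `l > mγ`: the moments bound the measure by a geometric
    -- sequence of ratio `mγ / l < 1`.
    have hle : ∀ j : ℕ, μ ≤ (m * γ / l) ^ (j + 1) / γ := by
      intro j
      obtain ⟨n, hn, hb⟩ := hmom j
      have hmark := mul_meas_ge_le_integral_of_nonneg
        (Eventually.of_forall fun x => pow_nonneg (abs_nonneg (v t x)) (n + 1))
        (integrable_abs_pow (h.curve.integrable t) (h.curve.abs_le t) (m := n + 1) (by omega))
        (l ^ (n + 1))
      have hset : {x | l ^ (n + 1) ≤ |v t x| ^ (n + 1)} = {x | l ≤ |v t x|} := by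
        ext x
        exact pow_le_pow_iff_left₀ hl0.le (abs_nonneg _) (Nat.succ_ne_zero n)
      rw [hset] at hmark
      have h1 : μ ≤ (m * γ / l) ^ (n + 1) / γ := by
        rw [div_pow, div_right_comm, le_div_iff₀ (by positivity), mul_comm]
        exact hmark.trans hb
      refine h1.trans (div_le_div_of_nonneg_right ?_ hγ0.le)
      exact pow_le_pow_of_le_one (by positivity) ((div_le_one hl0).2 hl.le) (by omega)
    have hlim : Tendsto (fun j : ℕ => (m * γ / l) ^ (j + 1) / γ) atTop (𝓝 0) := by
      have := ((tendsto_pow_atTop_nhds_zero_of_lt_one (by positivity)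
        ((div_lt_one hl0).2 hl)).comp (tendsto_add_atTop_nat 1)).div_const γ
      simpa using this
    have hμ0 : μ = 0 := le_antisymm (ge_of_tendsto' hlim hle) measureReal_nonneg
    have : volume {x | l ≤ |v t x|} = 0 := (measureReal_eq_zero_iff hfin).1 hμ0
    rw [ae_iff]
    simpa using this
  have hall : ∀ᵐ x, ∀ j : ℕ, |v t x| < m * γ + 1 / (j + 1 : ℝ) :=
    ae_all_iff.2 fun j => hlevel _ (lt_add_of_pos_right _ (by positivity))
  filter_upwards [hall] with x hx
  refine le_of_forall_pos_lt_add fun ε hε => ?_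
  obtain ⟨j, hj⟩ := exists_nat_one_div_lt hε
  linarith [hx j]

end IsMollifiedSolution

end Supremum

/-! ### Interpolation between `L¹` and `L^∞`. -/

theorem eLpNorm_le_rpow_mul {α : Type*} [MeasurableSpace α] {μ : Measure α} {f : α → ℝ}
    {I p : ℝ≥0∞} {γ : ℝ} (hγ : 0 < γ) (hp : 1 ≤ p)
    (hf : AEStronglyMeasurable f μ) (h1 : eLpNorm f 1 μ ≤ I)
    (h2 : ∀ᵐ x ∂μ, ‖f x‖ₑ ≤ I * ENNReal.ofReal γ) :
    eLpNorm f p μ ≤ ENNReal.ofReal (γ ^ (1 - (p⁻¹).toReal)) * I := by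
  rcases eq_or_ne p ⊤ with rfl | hpt
  · simp only [ENNReal.inv_top, ENNReal.toReal_zero, sub_zero, Real.rpow_one]
    rw [eLpNorm_exponent_top, mul_comm]
    exact essSup_le_of_ae_le _ h2
  have hp0 : p ≠ 0 := (one_pos.trans_le hp).ne'
  set r := p.toReal with hr
  have hr1 : 1 ≤ r := by
    rw [hr, ← ENNReal.toReal_one]
    exact (ENNReal.toReal_le_toReal ENNReal.one_ne_top hpt).2 hp
  have hr0 : 0 < r := by linarith
  rw [eLpNorm_eq_lintegral_rpow_enorm_toReal hp0 hpt, ENNReal.toReal_inv, ← hr]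
  set g := ENNReal.ofReal γ
  have hle : ∫⁻ x, ‖f x‖ₑ ^ r ∂μ ≤ I ^ r * g ^ (r - 1) := by
    -- Bound `r - 1` of the factors by the supremum and integrate the remaining one.
    calc ∫⁻ x, ‖f x‖ₑ ^ r ∂μ ≤ ∫⁻ x, (I * g) ^ (r - 1) * ‖f x‖ₑ ∂μ := by
          refine lintegral_mono_ae ?_
          filter_upwards [h2] with x hx
          have e : ‖f x‖ₑ ^ r = ‖f x‖ₑ ^ (r - 1) * ‖f x‖ₑ := by
            nth_rewrite 3 [← ENNReal.rpow_one ‖f x‖ₑ]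
            rw [← ENNReal.rpow_add_of_nonneg _ _ (by linarith) zero_le_one, sub_add_cancel]
          rw [e]
          gcongr
      _ ≤ (I * g) ^ (r - 1) * I := by
          have hc : (I * g) ^ (r - 1) * eLpNorm f 1 μ ≤ (I * g) ^ (r - 1) * I := by gcongr
          rw [eLpNorm_one_eq_lintegral_enorm] at hc
          rwa [lintegral_const_mul'' _ hf.enorm]
      _ = I ^ r * g ^ (r - 1) := by
          rw [ENNReal.mul_rpow_of_nonneg _ _ (by linarith), mul_right_comm]
          congr 1
          nth_rewrite 2 [← ENNReal.rpow_one I]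
          rw [← ENNReal.rpow_add_of_nonneg _ _ (by linarith) zero_le_one, sub_add_cancel]
  calc (∫⁻ x, ‖f x‖ₑ ^ r ∂μ) ^ (1 / r) ≤ (I ^ r * g ^ (r - 1)) ^ (1 / r) := by gcongr
    _ = ENNReal.ofReal (γ ^ (1 - r⁻¹)) * I := by
      rw [ENNReal.mul_rpow_of_nonneg _ _ (by positivity), ← ENNReal.rpow_mul, ← ENNReal.rpow_mul,
        mul_one_div_cancel hr0.ne', ENNReal.rpow_one, mul_comm, ENNReal.ofReal_rpow_of_pos hγ]
      congr 3
      field_simp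

/-! ### Reduction of weak solutions to mollified solutions. -/

section Reduction

variable {N : ℕ} {a : EuclideanSpace ℝ (Fin N)} {F : ℝ → ℝ} {u₀ : EuclideanSpace ℝ (Fin N) → ℝ}
  {u : ℝ → EuclideanSpace ℝ (Fin N) → ℝ}

namespace IsConvectionDiffusionSolution

/-- The space-time bound gives `|u s| ≤ M` only for almost every `s`. For any `t ≥ 0`, the integral
of the positive part of `|u t| - M` is at most `‖u s - u t‖₁` for good times `s > t` close to `t`,
hence zero by `L¹` continuity. -/
theorem exists_ae_bound (h : IsConvectionDiffusionSolution a F u₀ u) :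
    ∃ M : ℝ, 0 ≤ M ∧ ∀ t, 0 ≤ t → ∀ᵐ x, |u t x| ≤ M := by
  obtain ⟨M, hM0, hM⟩ : ∃ M : ℝ, 0 ≤ M ∧ ∀ᵐ q : ℝ × EuclideanSpace ℝ (Fin N)
      ∂(volume.restrict (Ioi (0 : ℝ) ×ˢ univ)), |u q.1 q.2| ≤ M := by
    set S := eLpNorm (Function.uncurry u) ⊤ (volume.restrict (Ioi (0 : ℝ) ×ˢ univ))
    have hS : S < ⊤ := h.memLp_top.2
    refine ⟨S.toReal, ENNReal.toReal_nonneg, ?_⟩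
    filter_upwards [ae_le_eLpNormEssSup (f := Function.uncurry u)
      (μ := volume.restrict (Ioi (0 : ℝ) ×ˢ (univ : Set (EuclideanSpace ℝ (Fin N)))))] with q hq
    rw [← eLpNorm_exponent_top] at hq
    have := ENNReal.toReal_mono hS.ne hq
    simpa [S, Function.uncurry] using this
  refine ⟨M, hM0, fun t ht => ?_⟩
  rw [Measure.volume_eq_prod, ← Measure.prod_restrict, Measure.restrict_univ] at hM
  have hgood : ∀ᵐ s ∂(volume.restrict (Ioi (0 : ℝ))), ∀ᵐ x, |u s x| ≤ M :=
    Measure.ae_ae_of_ae_prod hM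
  have hzero : ∫⁻ x, ENNReal.ofReal (|u t x| - M) = 0 := by
    refine le_antisymm (ENNReal.le_of_forall_pos_le_add fun ε hε _ => ?_) bot_le
    have hev : ∀ᶠ s in 𝓝[>] t, eLpNorm (u s - u t) 1 volume < ε :=
      ((h.continuous_L1 t ht).mono_left (nhdsWithin_mono t fun s hs =>
        (ht.trans (le_of_lt hs) : (0 : ℝ) ≤ s))).eventually_lt_const (by simpa using hε)
    obtain ⟨δ, hδ, hsub⟩ := mem_nhdsGT_iff_exists_Ioo_subset.1 hev
    have hex : ∃ s ∈ Ioo t δ, ∀ᵐ x, |u s x| ≤ M := by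
      by_contra hne
      have h0 : volume.restrict (Ioi (0 : ℝ)) (Ioo t δ) = 0 :=
        measure_mono_null (fun s hs hsM => hne ⟨s, hs, hsM⟩) (ae_iff.1 hgood)
      have hsub0 : Ioo t δ ⊆ Ioi 0 := fun s hs => lt_of_le_of_lt ht hs.1
      rw [Measure.restrict_apply measurableSet_Ioo, inter_eq_left.2 hsub0, Real.volume_Ioo, ENNReal.ofReal_eq_zero] at h0
      have : t < δ := hδ
      linarith
    obtain ⟨s, hs, hsM⟩ := hex
    have hlt : eLpNorm (u s - u t) 1 volume < ε := hsub hs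
    rw [zero_add]
    refine le_trans ?_ hlt.le
    rw [eLpNorm_one_eq_lintegral_enorm]
    refine lintegral_mono_ae ?_
    filter_upwards [hsM] with x hx
    rw [Pi.sub_apply, Real.enorm_eq_ofReal_abs]
    refine ENNReal.ofReal_le_ofReal ?_
    have := abs_sub_abs_le_abs_sub (u t x) (u s x)
    rw [abs_sub_comm] at this
    linarith
  have hmeas : AEMeasurable (fun x => ENNReal.ofReal (|u t x| - M)) volume :=
    ((h.memLp_one t ht).1.aemeasurable.abs.sub_const M).ennreal_ofReal
  filter_upwards [(lintegral_eq_zero_iff' hmeas).1 hzero] with x hx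
  have := ENNReal.ofReal_eq_zero.1 hx
  linarith

/-- Every solution has a bounded, pointwise measurable version whose mollifications solve the
mollified equation. -/
theorem exists_isMollifiedSolution (h : IsConvectionDiffusionSolution a F u₀ u)
    (hF : ContDiff ℝ 1 F) (hF0 : F 0 = 0) :
    ∃ v M K, IsMollifiedSolution a F v M K ∧ ∀ t, 0 ≤ t → v t =ᵐ[volume] u t := by
  obtain ⟨M, hM0, hM⟩ := h.exists_ae_bound
  obtain ⟨K, hK0, -, hK⟩ := exists_lipschitz_bound
    (fun s => ((hF.differentiable (by simp)) s).hasDerivAt) (hF.continuous_deriv (by simp)) M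
  have hmem : ∀ t, MemLp (u (max t 0)) 1 volume := fun t => h.memLp_one _ (le_max_right _ _)
  -- The curve is frozen at its initial value for negative times, replaced by measurable
  -- representatives, and truncated at `±M`, so that bounds and continuity hold at every time
  -- without exceptional sets.
  set g : ℝ → EuclideanSpace ℝ (Fin N) → ℝ := fun t => (hmem t).1.mk (u (max t 0)) with hg
  set v : ℝ → EuclideanSpace ℝ (Fin N) → ℝ := fun t x => max (-M) (min M (g t x)) with hv
  have hvM : ∀ t x, |v t x| ≤ M := fun t x =>
    abs_le.2 ⟨le_max_left _ _, max_le (by linarith) (min_le_left _ _)⟩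
  have hvu : ∀ t, v t =ᵐ[volume] u (max t 0) := by
    intro t
    filter_upwards [(hmem t).1.ae_eq_mk, hM _ (le_max_right t 0)] with x hx1 hx2
    have hgx : g t x = u (max t 0) x := hx1.symm
    simp only [hv, hgx]
    rw [min_eq_right (abs_le.1 hx2).2, max_eq_right (abs_le.1 hx2).1]
  have hvu' : ∀ t, 0 ≤ t → v t =ᵐ[volume] u t := fun t ht => by
    have := hvu t
    rwa [max_eq_left ht] at this
  have hcurve : IsBoundedL1Curve v M := by
    have hvi : ∀ t, Integrable (v t) := fun t =>
      (memLp_one_iff_integrable.1 (hmem t)).congr (hvu t).symm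
    refine ⟨fun t => measurable_const.max
      (measurable_const.min (hmem t).1.stronglyMeasurable_mk.measurable), hvi, hvM, fun t => ?_⟩
    have hmax : Tendsto (fun s : ℝ => max s 0) (𝓝 t) (𝓝[Ici 0] (max t 0)) :=
      tendsto_nhdsWithin_iff.2 ⟨(by fun_prop : Continuous fun s : ℝ => max s 0).tendsto t,
        Eventually.of_forall fun s => le_max_right s 0⟩
    have h1 := (h.continuous_L1 (max t 0) (le_max_right _ _)).comp hmax
    have h2 := (ENNReal.tendsto_toReal ENNReal.zero_ne_top).comp h1
    rw [ENNReal.toReal_zero] at h2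
    refine h2.congr fun s => ?_
    have hae : (u (max s 0) - u (max t 0)) =ᵐ[volume] fun x => v s x - v t x :=
      ((hvu s).sub (hvu t)).symm
    simp only [Function.comp_apply]
    rw [eLpNorm_congr_ae hae, eLpNorm_one_eq_lintegral_enorm]
    exact (integral_norm_eq_lintegral_enorm ((hvi s).sub (hvi t)).aestronglyMeasurable).symm
  have hflux := hcurve.comp hF.continuous hF0 hK hK0
  refine ⟨v, M, K, ⟨hcurve, hF.continuous, hF0, hK0, hK, fun k hk x t ht => ?_⟩, hvu'⟩
  refine hasDerivAt_mollify_of_weak hcurve hflux (fun φ hφ => ?_) hk x ht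
  refine Eq.trans ?_ ((h.equation φ hφ).trans ?_)
  · refine setIntegral_congr_fun measurableSet_Ioi fun s hs => integral_congr_ae ?_
    filter_upwards [hvu' s (le_of_lt hs)] with y hy
    rw [hy]
  · refine setIntegral_congr_fun measurableSet_Ioi fun s hs => integral_congr_ae ?_
    filter_upwards [hvu' s (le_of_lt hs)] with y hy
    rw [hy]

end IsConvectionDiffusionSolution

end Reduction

/-! ### The decay estimate. -/

theorem theorem4p2 (N : ℕ) (hN : 1 ≤ N) (p : ℝ≥0∞) (hp : 1 ≤ p) :
    ∃ C : ℝ, 0 < C ∧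
      ∀ (a : EuclideanSpace ℝ (Fin N)) (F : ℝ → ℝ), ContDiff ℝ 1 F → F 0 = 0 →
      ∀ u₀ : EuclideanSpace ℝ (Fin N) → ℝ, MemLp u₀ 1 volume → MemLp u₀ ⊤ volume →
      ∀ u : ℝ → EuclideanSpace ℝ (Fin N) → ℝ, IsConvectionDiffusionSolution a F u₀ u →
      ∀ t : ℝ, 0 < t →
        eLpNorm (u t) p volume ≤
          ENNReal.ofReal (C * t ^ (-((N : ℝ) / 2) * (1 - (p⁻¹).toReal))) *
            eLpNorm u₀ 1 volume := by
  have hd : 1 ≤ Module.finrank ℝ (EuclideanSpace ℝ (Fin N)) := by simpa using hN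
  have hB := decayConst_pos hd
  -- The supremum bound is `‖u₀‖₁` times `decayConst * t ^ (-N/2)`; interpolation raises this factor
  -- to the power `1 - 1/p`.
  refine ⟨decayConst (EuclideanSpace ℝ (Fin N)) ^ (1 - (p⁻¹).toReal), Real.rpow_pos_of_pos hB _,
    fun a F hF hF0 u₀ _ _ u hu t ht => ?_⟩
  obtain ⟨v, M, K, hv, hvu⟩ := hu.exists_isMollifiedSolution hF hF0
  have hI : ∀ s, eLpNorm (v s) 1 volume = ENNReal.ofReal (∫ x, |v s x|) := fun s => by
    rw [eLpNorm_one_eq_lintegral_enorm]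
    exact (ofReal_integral_norm_eq_lintegral_enorm (hv.curve.integrable s)).symm
  rw [← eLpNorm_congr_ae (hvu t ht.le),
    ← eLpNorm_congr_ae ((hvu 0 le_rfl).trans hu.initial)]
  have hγ : 0 < decayConst (EuclideanSpace ℝ (Fin N)) * t ^ (-((N : ℝ) / 2)) :=
    mul_pos hB (Real.rpow_pos_of_pos ht _)
  have key := eLpNorm_le_rpow_mul (f := v t) (μ := volume) (I := eLpNorm (v 0) 1 volume) hγ hp
    (hv.curve.measurable t).aestronglyMeasurable
    (by rw [hI, hI]; exact ENNReal.ofReal_le_ofReal (hv.integral_abs_le ht.le)) (by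
      have := hv.ae_abs_le hd ht
      rw [finrank_euclideanSpace_fin] at this
      filter_upwards [this] with x hx
      rw [hI, ← ENNReal.ofReal_mul (integral_nonneg fun x => abs_nonneg _),
        Real.enorm_eq_ofReal_abs]
      exact ENNReal.ofReal_le_ofReal hx)
  rwa [Real.mul_rpow hB.le (Real.rpow_nonneg ht.le _), ← Real.rpow_mul ht.le] at key
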